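/- Let $n\ge 0$, let $V=\mathbb C^{2n}$ with its standard symplectic form $\langle\,,\rangle$, $G=\mathrm{Sp}(2n)$, $\mathfrak g=\mathfrak{sp}(2n)$, $\mathbf F=\mathbb C((t))$, $\mathbf O=\mathbb C[[t]]$. Equip $V_{\mathbf F}=V\otimes\mathbf F$ with the $\mathbb C$-valued symplectic form $\mathrm{Res}\,\langle f,g\rangle_{\mathbf F}\,dt$. Identify the affine Grassmannian $\mathrm{Gr}_G=G_{\mathbf F}/G_{\mathbf O}$ with the space of parahoric subalgebras $\mathfrak p=\mathrm{Ad}_g\,\mathfrak g_{\mathbf O}\subset\mathfrak g_{\mathbf F}$, $g\in G_{\mathbf F}$, and $T^*\mathrm{Gr}_G$ with the space of pairs $(\mathfrak p,x)$, where $x\in\mathfrak p^\perp=(\mathfrak g_{\mathbf F}/\mathfrak p)^*$, the orthogonal complement being taken in $\mathfrak g_{\mathbf F}$ for the pairing $\mathrm{Res}\,\mathrm{tr}(xy)\,dt$. The group $G_{\mathbf O}$ acts on $V_{\mathbf F}\times T^*\mathrm{Gr}_G$, which carries the product of the above symplectic form and the canonical one, $-d\theta$ with $\theta=\mathrm{Res}\,\mathrm{tr}(x\cdot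 dg\,g^{-1})\,dt$; the moment map $\boldsymbol\mu\colon V_{\mathbf F}\times T^*\mathrm{Gr}_G\to\mathfrak g_{\mathbf O}^*$ is $$\langle\boldsymbol\mu(v,\mathfrak p,x),\xi\rangle=\tfrac12\,\mathrm{Res}\,\langle \xi v,v\rangle\,dt+\mathrm{Res}\,\mathrm{tr}(x\xi)\,dt\qquad(\xi\in\mathfrak g_{\mathbf O}).$$ **Lemma.** The zero level $\boldsymbol\mu^{-1}(0)\subset V_{\mathbf F}\times T^*\mathrm{Gr}_G$ (with its reduced structure) is Lagrangian, that is: 1. (isotropic) for every integral domain $R$ over $\mathbb C$, every $R$-point of $\boldsymbol\mu^{-1}(0)$ whose component in $\mathrm{Gr}_G$ lifts to $G(R((t)))$, and every pair of $\mathbb C$-linear derivations $D_1,D_2$ of $R$, the pull-back to $\mathrm{Spec}\,R$ of the symplectic form takes the value $0$ on $(D_1,D_2)$; 2. (coisotropic) for every $\mathbb C$-point $z$ of $\boldsymbol\mu^{-1}(0)$, let $T_z$ be the set of velocities at $s=0$ of the arcs $\mathrm{Spec}\,\mathbb C[[s]]\to\boldsymbol\mu^{-1}(0)$ with value $z$ at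 $s=0$ (at a smooth point of the reduced zero level, this is its tangent space). Then every tangent vector to $V_{\mathbf F}\times T^*\mathrm{Gr}_G$ at $z$ that is orthogonal to all of $T_z$ lies in $T_z$. -/

import Mathlib

open scoped Matrix

noncomputable section

namespace Mirabolic

variable {n : ℕ} {R : Type} [CommRing R]

/-- `V_F` with coefficients in `R`: column vectors of length `2n` over `R((t))`. -/
abbrev Vec (n : ℕ) (R : Type) [CommRing R] : Type :=
  Fin n ⊕ Fin n → LaurentSeries R

/-- `2n × 2n` matrices over `R((t))`. -/
abbrev Mat (n : ℕ) (R : Type) [CommRing R] : Type :=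
  Matrix (Fin n ⊕ Fin n) (Fin n ⊕ Fin n) (LaurentSeries R)

/-- The residue of `f dt`. -/
def res (f : LaurentSeries R) : R := HahnSeries.coeff f (-1)

/-- The standard `R((t))`-valued symplectic form on `V_F`. -/
def form (u v : Vec n R) : LaurentSeries R :=
  u ⬝ᵥ (Matrix.J (Fin n) (LaurentSeries R) *ᵥ v)

/-- The `R`-valued invariant pairing `Res tr(AB) dt` of matrices of Laurent series. -/
def trPairing (A B : Mat n R) : R := res (Matrix.trace (A * B))

attribute [local instance] LieRing.ofAssociativeRing

/-- The loop algebra `g_F = sp(2n, R((t)))`. -/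
abbrev spF (n : ℕ) (R : Type) [CommRing R] :
    LieSubalgebra (LaurentSeries R) (Mat n R) :=
  LieAlgebra.Symplectic.sp (Fin n) (LaurentSeries R)

theorem smul_eq_C_smul (c : R) (A : Mat n R) :
    c • A = (HahnSeries.C c : LaurentSeries R) • A := by
  ext i j m
  simp

/-- The arc algebra `g_O = sp(2n, R[[t]])`. -/
def spO (n : ℕ) (R : Type) [CommRing R] : Submodule R (Mat n R) where
  carrier := {A | A ∈ spF n R ∧ ∀ i j, ∀ m : ℤ, m < 0 → HahnSeries.coeff (A i j) m = 0}
  add_mem' := by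
    rintro A B ⟨hA, hA'⟩ ⟨hB, hB'⟩
    refine ⟨add_mem hA hB, fun i j m hm => ?_⟩
    simp [hA' i j m hm, hB' i j m hm]
  zero_mem' := ⟨zero_mem _, fun i j m _ => by simp⟩
  smul_mem' := by
    rintro c A ⟨hA, hA'⟩
    refine ⟨?_, fun i j m hm => ?_⟩
    · rw [smul_eq_C_smul]
      exact (spF n R).smul_mem _ hA
    · simp [hA' i j m hm]

/-- The parahoric subalgebra `Ad_g g_O`. -/
def parahoric (g : Mat n R) : Set (Mat n R) :=
  {A | ∃ b ∈ spO n R, A = g * b * g⁻¹}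

/-- The annihilator `{x ∈ g_F | Res tr(xb) dt = 0 for all b ∈ p}` of `p ⊆ g_F`. For a parahoric
`p = Ad_g g_O` this is the cotangent space `(g_F / p)^*` of the affine Grassmannian at `p`. -/
def annihilator (p : Set (Mat n R)) : Set (Mat n R) :=
  {x | x ∈ spF n R ∧ ∀ b ∈ p, trPairing x b = 0}

/-- The `R`-points `(v, p, x)` of `V_F × T^*Gr_G`, `G = Sp(2n)`. A point of the affine
Grassmannian is a parahoric subalgebra `p` conjugate to `g_O`; a cotangent vector at `p` is an
element `x` of `p^⊥ = (g_F / p)^*`. (Families are those that lift to the loop group; every family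
does so étale locally.) -/
structure Point (n : ℕ) (R : Type) [CommRing R] where
  v : Vec n R
  p : Set (Mat n R)
  x : Mat n R
  exists_lift : ∃ g ∈ Matrix.symplecticGroup (Fin n) (LaurentSeries R), p = parahoric g
  x_mem : x ∈ annihilator p

variable [Algebra ℂ R]

/-- The moment map `V_F × T^*Gr_G → g_O^*` of the `G_O`-action:
`⟨μ(v, p, x), ξ⟩ = ½ Res ⟨ξv, v⟩ dt + Res tr(xξ) dt`. -/
def moment (z : Point n R) : Module.Dual R (spO n R) where
  toFun ξ := (1 / 2 : ℂ) • res (form (ξ.1 *ᵥ z.v) z.v) + trPairing z.x ξ.1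
  map_add' ξ η := by
    simp only [Submodule.coe_add, Matrix.add_mulVec, form, add_dotProduct, trPairing,
      Matrix.mul_add, Matrix.trace_add, res, HahnSeries.coeff_add, smul_add]
    ring
  map_smul' c ξ := by
    have h : ((c • ξ : spO n R) : Mat n R) = (HahnSeries.C c : LaurentSeries R) • (ξ : Mat n R) :=
      smul_eq_C_smul c ξ.1
    simp only [h, form, trPairing, res, RingHom.id_apply, Matrix.smul_mulVec, smul_dotProduct,
      Matrix.trace_smul, smul_eq_mul, HahnSeries.C_mul_eq_smul,
      HahnSeries.coeff_smul, mul_add, mul_smul_comm]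

/-- The `R`-points of the zero level of the moment map. -/
def zeroLevel (n : ℕ) (R : Type) [CommRing R] [Algebra ℂ R] : Set (Point n R) :=
  {z | moment z = 0}

/-- Representatives of tangent vectors to `V_F × T^*Gr_G`: `w` is the derivative of `v`,
`a = (dg) g⁻¹` is the derivative of `p = Ad_g g_O` (it matters only modulo `p`), and `y` is the
derivative of `x`. -/
@[ext] structure Tangent (n : ℕ) (R : Type) [CommRing R] where
  w : Vec n R
  a : Mat n R
  y : Mat n R

/-- The tangent space at `z`: differentiating `x ∈ p^⊥ = Ad_g (g_O^⊥)` gives the condition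
`y - [a, x] ∈ p^⊥`. Two representatives define the same tangent vector iff they have equal `w`, `y`
and their `a` differ by an element of `p`. -/
def tangentSpace (z : Point n R) : Set (Tangent n R) :=
  {τ | τ.a ∈ spF n R ∧ τ.y ∈ spF n R ∧ τ.y - ⁅τ.a, z.x⁆ ∈ annihilator z.p}

/-- The symplectic form `Res ⟨ , ⟩ dt - dθ` of `V_F × T^*Gr_G`, where
`θ = Res tr(x · (dg) g⁻¹) dt` is the Liouville form of `T^*Gr_G`. The vectors
`(0, a, 0)`, `a ∈ p`, are in its kernel, so it is a form on tangent vectors. -/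
def sympForm (z : Point n R) (τ σ : Tangent n R) : R :=
  res (form τ.w σ.w) +
    (trPairing σ.y τ.a - trPairing τ.y σ.a - trPairing z.x ⁅τ.a, σ.a⁆)

/-- Apply a linear map to the coefficients of a vector of Laurent series. -/
def mapVec {S : Type} [CommRing S] [Algebra ℂ S] (δ : R →ₗ[ℂ] S) (v : Vec n R) : Vec n S :=
  fun i => HahnSeries.map (v i) δ

/-- Apply a linear map to the coefficients of a matrix of Laurent series. -/
def mapMat {S : Type} [CommRing S] [Algebra ℂ S] (δ : R →ₗ[ℂ] S) (A : Mat n R) : Mat n S :=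
  fun i j => HahnSeries.map (A i j) δ

/-- The derivative of a family `z` of points, with lift `g` of `p` to the loop group, along a
derivation `δ : R → S` over a ring homomorphism `φ : R → S`. -/
def velocity {S : Type} [CommRing S] [Algebra ℂ S] (φ δ : R →ₗ[ℂ] S) (z : Point n R)
    (g : Mat n R) : Tangent n S where
  w := mapVec δ z.v
  a := mapMat δ g * (mapMat φ g)⁻¹
  y := mapMat δ z.x

/-- `Z` is isotropic: the pull-back of the symplectic form to every family of points of `Z`
parametrized by an integral `ℂ`-scheme `Spec R` vanishes (on all pairs of vector fields). For the
function field of a subvariety this says that the form vanishes on its smooth locus. -/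
def IsIsotropic (Z : ∀ (R : Type) [CommRing R] [Algebra ℂ R], Set (Point n R)) : Prop :=
  ∀ (R : Type) [CommRing R] [IsDomain R] [Algebra ℂ R], ∀ z ∈ Z R,
    ∀ g ∈ Matrix.symplecticGroup (Fin n) (LaurentSeries R), z.p = parahoric g →
      ∀ D₁ D₂ : Derivation ℂ R R,
        sympForm z (velocity LinearMap.id (D₁ : R →ₗ[ℂ] R) z g)
          (velocity LinearMap.id (D₂ : R →ₗ[ℂ] R) z g) = 0

/-- The vectors tangent to `Z` at the complex point `z`: the velocities at `s = 0` of the formal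
arcs `Spec ℂ[[s]] → Z` through `z`. At a smooth point of the reduced space `Z` this is its tangent
space. -/
def tangentsTo (Z : ∀ (R : Type) [CommRing R] [Algebra ℂ R], Set (Point n R))
    (z : Point n ℂ) : Set (Tangent n ℂ) :=
  {τ | ∃ γ ∈ Z (PowerSeries ℂ),
    ∃ g ∈ Matrix.symplecticGroup (Fin n) (LaurentSeries (PowerSeries ℂ)), γ.p = parahoric g ∧
      mapVec (PowerSeries.coeff 0) γ.v = z.v ∧
      parahoric (mapMat (PowerSeries.coeff 0) g) = z.p ∧
      mapMat (PowerSeries.coeff 0) γ.x = z.x ∧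
      velocity (PowerSeries.coeff 0) (PowerSeries.coeff 1) γ g = τ}

/-- `Z` is coisotropic: at every complex point of `Z`, singular points included, each tangent
vector of the ambient space that is orthogonal to all vectors tangent to `Z` is itself tangent
to `Z`. -/
def IsCoisotropic (Z : ∀ (R : Type) [CommRing R] [Algebra ℂ R], Set (Point n R)) : Prop :=
  ∀ z ∈ Z ℂ, ∀ τ ∈ tangentSpace z,
    (∀ σ ∈ tangentsTo Z z, sympForm z τ σ = 0) → τ ∈ tangentsTo Z z

/-- `Z` is Lagrangian: isotropic and coisotropic. -/
def IsLagrangian (Z : ∀ (R : Type) [CommRing R] [Algebra ℂ R], Set (Point n R)) : Prop :=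
  IsIsotropic Z ∧ IsCoisotropic Z

end Mirabolic

end

/-! Write `O` for the power series and `A` for the order of all matrices (not only those in `sp`)
that preserve both the standard lattice and its translate by `g`. Since `g_O` is its own annihilator
under the residue pairing, so is `p`, and the zero level is cut out by two integrality conditions:
`x ∈ p`, and `x + quad v` has entries in `O` (`mem_zeroLevel_iff`). They force `Av` to be isotropic:
`⟨av, bv⟩ ∈ O` for `a, b ∈ A` (`sform_mulVec_mem`).

Isotropy. Pass to the fraction field `K`, where elementary divisors give `g = k D h`. A derivation
of the coefficients does not lower the order in `t`, so logarithmic derivatives of scalars are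
integral. Hence `(dg)g⁻¹ = ξ + β` with `ξ ∈ g_O`, `β ∈ p`, and, applying the same remark to the
coordinates of `k⁻¹v`, `dv = ξv + αv` with `α ∈ A` (`exists_split_logDeriv`). Modulo the action of
`ξ`, which contracts with the symplectic form to the differential of the moment map (`preForm_eq`),
two velocities pair to `Res ⟨α₁v, α₂v⟩ = 0`.

Coisotropy. Explicit arcs, quadratic in the parameter up to the group action, realise many tangent
vectors (`mem_tangentsTo`). Let `τ` be orthogonal to all of these. Cotangent test vectors and
biduality of lattices give `τ.a ∈ g_O + p`; the group directions give the linearised moment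
equation. After the action is removed, a vector `w` remains. The test vectors over the lattice `Λ =
Av + (V_O ∩ (Av)^⊥)` show that `w ⊥ Λ`. This `Λ` is self-dual (`mem_adaptedLattice_of_res`), so `w ∈
Λ`, and then `τ` is one of the explicit tangent vectors. -/

open scoped Matrix

noncomputable section

namespace Mirabolic

attribute [local instance] LieRing.ofAssociativeRing

/-! ### Symplectic linear algebra over a commutative ring. -/

section SymplecticAlgebra

variable {l S : Type*} [Fintype l] [DecidableEq l] [CommRing S]

/-- The standard symplectic form over an arbitrary commutative ring. -/
def sform (u v : l ⊕ l → S) : S := u ⬝ᵥ (Matrix.J l S *ᵥ v)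

/-- The adjoint of a matrix with respect to the standard symplectic form. -/
def sadj (A : Matrix (l ⊕ l) (l ⊕ l) S) : Matrix (l ⊕ l) (l ⊕ l) S :=
  -(Matrix.J l S * Aᵀ * Matrix.J l S)

/-- The element of `sp` representing `ξ ↦ ⟨ξu, v⟩` with respect to the trace pairing. -/
def symSq (u v : l ⊕ l → S) : Matrix (l ⊕ l) (l ⊕ l) S :=
  -((Matrix.vecMulVec u v + Matrix.vecMulVec v u) * Matrix.J l S)

theorem J_mul_J_mul (A : Matrix (l ⊕ l) (l ⊕ l) S) :
    Matrix.J l S * (Matrix.J l S * A) = -A := by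
  rw [← Matrix.mul_assoc, Matrix.J_squared, neg_one_mul]

theorem sadj_add (A B : Matrix (l ⊕ l) (l ⊕ l) S) : sadj (A + B) = sadj A + sadj B := by
  simp only [sadj, Matrix.transpose_add, Matrix.mul_add, Matrix.add_mul, neg_add]

theorem sadj_neg (A : Matrix (l ⊕ l) (l ⊕ l) S) : sadj (-A) = -sadj A := by
  simp [sadj]

theorem sadj_sub (A B : Matrix (l ⊕ l) (l ⊕ l) S) : sadj (A - B) = sadj A - sadj B := by
  rw [sub_eq_add_neg, sadj_add, sadj_neg, sub_eq_add_neg]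

theorem sadj_smul (c : S) (A : Matrix (l ⊕ l) (l ⊕ l) S) : sadj (c • A) = c • sadj A := by
  simp [sadj]

theorem sadj_one : sadj (1 : Matrix (l ⊕ l) (l ⊕ l) S) = 1 := by
  simp [sadj, Matrix.J_squared]

theorem sadj_mul (A B : Matrix (l ⊕ l) (l ⊕ l) S) : sadj (A * B) = sadj B * sadj A := by
  simp only [sadj, Matrix.transpose_mul, Matrix.mul_assoc, Matrix.neg_mul, Matrix.mul_neg,
    J_mul_J_mul, neg_neg]

theorem sadj_sadj (A : Matrix (l ⊕ l) (l ⊕ l) S) : sadj (sadj A) = A := by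
  simp only [sadj, Matrix.transpose_mul, Matrix.transpose_neg, Matrix.mul_assoc, Matrix.neg_mul,
    Matrix.mul_neg, J_mul_J_mul, neg_neg, Matrix.transpose_transpose, Matrix.J_transpose,
    Matrix.J_squared, Matrix.mul_one]

theorem trace_sadj (A : Matrix (l ⊕ l) (l ⊕ l) S) : (sadj A).trace = A.trace := by
  rw [sadj, Matrix.mul_assoc, Matrix.trace_neg, Matrix.trace_mul_comm, Matrix.mul_assoc,
    Matrix.J_squared, Matrix.mul_neg, Matrix.mul_one, Matrix.trace_neg, neg_neg,
    Matrix.trace_transpose]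

theorem sform_comm (u v : l ⊕ l → S) : sform u v = -sform v u := by
  rw [sform, Matrix.dotProduct_mulVec, ← Matrix.mulVec_transpose, Matrix.J_transpose,
    Matrix.neg_mulVec, neg_dotProduct, dotProduct_comm, sform]

theorem sform_add_left (u u' v : l ⊕ l → S) : sform (u + u') v = sform u v + sform u' v := by
  simp [sform, add_dotProduct]

theorem sform_add_right (u v v' : l ⊕ l → S) : sform u (v + v') = sform u v + sform u v' := by
  simp [sform, Matrix.mulVec_add, dotProduct_add]

theorem sform_smul_right (c : S) (u v : l ⊕ l → S) : sform u (c • v) = c * sform u v := by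
  simp [sform, Matrix.mulVec_smul]

theorem sform_neg_left (u v : l ⊕ l → S) : sform (-u) v = -sform u v := by
  simp [sform]

theorem sform_sub_left (u u' v : l ⊕ l → S) : sform (u - u') v = sform u v - sform u' v := by
  simp [sform, sub_dotProduct]

theorem sform_mulVec (A : Matrix (l ⊕ l) (l ⊕ l) S) (u v : l ⊕ l → S) :
    sform (A *ᵥ u) v = sform u (sadj A *ᵥ v) := by
  rw [sform, sform, sadj, Matrix.mulVec_mulVec, Matrix.mul_neg, Matrix.mul_assoc, J_mul_J_mul,
    neg_neg, ← Matrix.mulVec_mulVec, Matrix.dotProduct_mulVec, ← Matrix.mulVec_transpose,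
    Matrix.dotProduct_mulVec u, ← Matrix.mulVec_transpose, Matrix.transpose_transpose,
    Matrix.dotProduct_mulVec, ← Matrix.mulVec_transpose]

theorem mem_sp_iff {A : Matrix (l ⊕ l) (l ⊕ l) S} :
    A ∈ LieAlgebra.Symplectic.sp l S ↔ sadj A = -A := by
  have : A ∈ LieAlgebra.Symplectic.sp l S ↔ Aᵀ * Matrix.J l S = Matrix.J l S * -A := by
    rw [LieAlgebra.Symplectic.sp, mem_skewAdjointMatricesLieSubalgebra,
      mem_skewAdjointMatricesSubmodule]
    rfl
  rw [this, sadj, Matrix.mul_assoc]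
  constructor
  · intro h
    rw [h, J_mul_J_mul, neg_neg]
  · intro h
    rw [← h, Matrix.mul_neg, J_mul_J_mul, neg_neg]

theorem mul_sadj_of_mem {g : Matrix (l ⊕ l) (l ⊕ l) S} (hg : g ∈ Matrix.symplecticGroup l S) :
    g * sadj g = 1 := by
  rw [SymplecticGroup.mem_iff] at hg
  rw [sadj, Matrix.mul_neg, ← Matrix.mul_assoc, ← Matrix.mul_assoc, hg, Matrix.J_squared, neg_neg]

theorem sadj_mul_of_mem {g : Matrix (l ⊕ l) (l ⊕ l) S} (hg : g ∈ Matrix.symplecticGroup l S) :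
    sadj g * g = 1 :=
  mul_eq_one_comm.mp (mul_sadj_of_mem hg)

theorem inv_eq_sadj {g : Matrix (l ⊕ l) (l ⊕ l) S} (hg : g ∈ Matrix.symplecticGroup l S) :
    g⁻¹ = sadj g :=
  Matrix.inv_eq_right_inv (mul_sadj_of_mem hg)

theorem mem_symplecticGroup_of_mul_sadj {g : Matrix (l ⊕ l) (l ⊕ l) S} (hg : g * sadj g = 1) :
    g ∈ Matrix.symplecticGroup l S := by
  rw [SymplecticGroup.mem_iff]
  have h := congrArg (· * Matrix.J l S) hg
  simp only [sadj, Matrix.mul_neg, Matrix.neg_mul, Matrix.mul_assoc, Matrix.J_squared,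
    Matrix.mul_one, neg_neg, Matrix.one_mul] at h
  rw [Matrix.mul_assoc, h]

theorem symSq_comm (u v : l ⊕ l → S) : symSq u v = symSq v u := by
  rw [symSq, symSq, add_comm]

theorem symSq_add_left (u u' v : l ⊕ l → S) : symSq (u + u') v = symSq u v + symSq u' v := by
  simp only [symSq, Matrix.add_vecMulVec, Matrix.vecMulVec_add, Matrix.add_mul]
  abel

theorem symSq_add_right (u v v' : l ⊕ l → S) : symSq u (v + v') = symSq u v + symSq u v' := by
  rw [symSq_comm, symSq_add_left, symSq_comm, symSq_comm v']

theorem symSq_smul_left (c : S) (u v : l ⊕ l → S) : symSq (c • u) v = c • symSq u v := by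
  simp only [symSq, Matrix.smul_vecMulVec, Matrix.vecMulVec_smul, Matrix.add_mul, Matrix.smul_mul,
    smul_add, smul_neg]

theorem symSq_smul_right (c : S) (u v : l ⊕ l → S) : symSq u (c • v) = c • symSq u v := by
  rw [symSq_comm, symSq_smul_left, symSq_comm]

theorem symSq_sub_right (u v v' : l ⊕ l → S) : symSq u (v - v') = symSq u v - symSq u v' := by
  rw [eq_sub_iff_add_eq, ← symSq_add_right, sub_add_cancel]

theorem sadj_symSq (u v : l ⊕ l → S) : sadj (symSq u v) = -symSq u v := by
  rw [symSq, sadj_neg, sadj, Matrix.transpose_mul, Matrix.J_transpose, Matrix.transpose_add,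
    Matrix.transpose_vecMulVec, Matrix.transpose_vecMulVec, Matrix.neg_mul, Matrix.mul_neg,
    J_mul_J_mul, neg_neg, Matrix.neg_mul, Matrix.neg_mul, add_comm]

theorem symSq_mulVec_mulVec (A : Matrix (l ⊕ l) (l ⊕ l) S) (u v : l ⊕ l → S) :
    symSq (A *ᵥ u) (A *ᵥ v) = A * symSq u v * sadj A := by
  have h (u v : l ⊕ l → S) : Matrix.vecMulVec (A *ᵥ u) (A *ᵥ v) = A * Matrix.vecMulVec u v * Aᵀ := by
    rw [Matrix.mul_vecMulVec, Matrix.vecMulVec_mul, ← Matrix.mulVec_transpose,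
      Matrix.transpose_transpose]
  simp only [symSq, h, sadj, Matrix.mul_neg, Matrix.neg_mul, Matrix.mul_assoc, J_mul_J_mul,
    Matrix.mul_add, Matrix.add_mul, neg_neg, neg_add]

/-- The part of `symSq_mulVec_mulVec` for `1 + A` that is linear in `A`. -/
theorem symSq_mulVec_add (A : Matrix (l ⊕ l) (l ⊕ l) S) (u v : l ⊕ l → S) :
    symSq (A *ᵥ u) v + symSq u (A *ᵥ v) = A * symSq u v + symSq u v * sadj A := by
  have h := symSq_mulVec_mulVec (1 + A) u v
  rw [Matrix.add_mulVec, Matrix.add_mulVec, symSq_add_left, symSq_add_right, symSq_add_right,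
    Matrix.one_mulVec, Matrix.one_mulVec, symSq_mulVec_mulVec, sadj_add, sadj_one, add_mul, add_mul,
    mul_add, mul_add, one_mul, mul_one, mul_one] at h
  have e : symSq (A *ᵥ u) v + symSq u (A *ᵥ v) = (symSq u v + symSq u (A *ᵥ v) +
      (symSq (A *ᵥ u) v + A * symSq u v * sadj A)) - symSq u v - A * symSq u v * sadj A := by abel
  rw [e, h]
  abel

theorem trace_symSq_mul (u v : l ⊕ l → S) (A : Matrix (l ⊕ l) (l ⊕ l) S) :
    (symSq u v * A).trace = sform (A *ᵥ u) v + sform (A *ᵥ v) u := by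
  have h (u v : l ⊕ l → S) : (Matrix.vecMulVec u v * (Matrix.J l S * A)).trace
      = - sform (A *ᵥ u) v := by
    rw [Matrix.vecMulVec_mul, Matrix.trace_vecMulVec, dotProduct_comm, ← Matrix.dotProduct_mulVec,
      ← Matrix.mulVec_mulVec, ← sform, sform_comm]
  rw [symSq, Matrix.neg_mul, Matrix.trace_neg, Matrix.mul_assoc, Matrix.add_mul, Matrix.trace_add,
    h, h]
  ring

theorem sform_mulVec_of_skew {A : Matrix (l ⊕ l) (l ⊕ l) S} (hA : sadj A = -A) (u v : l ⊕ l → S) :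
    sform (A *ᵥ u) v = sform (A *ᵥ v) u := by
  rw [sform_mulVec, hA, Matrix.neg_mulVec, sform_comm, sform_neg_left, neg_neg]

theorem trace_symSq_mul_of_skew {c : S} (hc : 2 * c = 1) {A : Matrix (l ⊕ l) (l ⊕ l) S}
    (hA : sadj A = -A) (u v : l ⊕ l → S) : (c • symSq u v * A).trace = sform (A *ᵥ u) v := by
  rw [Matrix.smul_mul, Matrix.trace_smul, trace_symSq_mul, ← sform_mulVec_of_skew hA u v, smul_eq_mul]
  linear_combination (sform (A *ᵥ u) v) * hc

/-- The symplectic form of `V × T^*Gr` before taking residues. -/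
def preForm (x : Matrix (l ⊕ l) (l ⊕ l) S) (w₁ : l ⊕ l → S) (a₁ y₁ : Matrix (l ⊕ l) (l ⊕ l) S)
    (w₂ : l ⊕ l → S) (a₂ y₂ : Matrix (l ⊕ l) (l ⊕ l) S) : S :=
  sform w₁ w₂ + ((y₂ * a₁).trace - (y₁ * a₂).trace - (x * (a₁ * a₂ - a₂ * a₁)).trace)

/-- The symplectic form modulo the directions of the group action, which are contracted with the
differential of the moment map. -/
theorem preForm_eq {c : S} (hc : 2 * c = 1) {x ξ₁ ξ₂ b₁ b₂ y₁ y₂ : Matrix (l ⊕ l) (l ⊕ l) S}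
    (h₁ : sadj ξ₁ = -ξ₁) (h₂ : sadj ξ₂ = -ξ₂) (v w₁ w₂ : l ⊕ l → S) :
    preForm x (ξ₁ *ᵥ v + w₁) (ξ₁ + b₁) (ξ₁ * x - x * ξ₁ + y₁)
      (ξ₂ *ᵥ v + w₂) (ξ₂ + b₂) (ξ₂ * x - x * ξ₂ + y₂) =
    sform w₁ w₂ + ((y₂ + c • symSq v w₂) * ξ₁).trace - ((y₁ + c • symSq v w₁) * ξ₂).trace
      + (y₂ * b₁).trace - (y₁ * b₂).trace - (x * (b₁ * b₂ - b₂ * b₁)).trace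
      + ((x + c • c • symSq v v) * (ξ₁ * ξ₂ - ξ₂ * ξ₁)).trace := by
  have cyc (A B : Matrix (l ⊕ l) (l ⊕ l) S) :
      (A * (x * B)).trace = (x * (B * A)).trace := by
    rw [Matrix.trace_mul_comm, Matrix.mul_assoc]
  have hsk : sadj (ξ₁ * ξ₂ - ξ₂ * ξ₁) = -(ξ₁ * ξ₂ - ξ₂ * ξ₁) := by
    simp only [sadj_sub, sadj_mul, h₁, h₂, Matrix.neg_mul, Matrix.mul_neg, neg_neg, neg_sub]
  have e₀ : (c • c • symSq v v * (ξ₁ * ξ₂ - ξ₂ * ξ₁)).trace = sform (ξ₁ *ᵥ v) (ξ₂ *ᵥ v) := by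
    have e₁ : sform (ξ₁ *ᵥ (ξ₂ *ᵥ v)) v = sform (ξ₁ *ᵥ v) (ξ₂ *ᵥ v) := by
      rw [sform_mulVec_of_skew h₁]
    have e₂ : sform (ξ₂ *ᵥ (ξ₁ *ᵥ v)) v = -sform (ξ₁ *ᵥ v) (ξ₂ *ᵥ v) := by
      rw [sform_mulVec_of_skew h₂, sform_comm]
    rw [smul_comm, Matrix.smul_mul, Matrix.trace_smul, trace_symSq_mul_of_skew hc hsk,
      Matrix.sub_mulVec, ← Matrix.mulVec_mulVec, ← Matrix.mulVec_mulVec, sform_sub_left, e₁, e₂,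
      smul_eq_mul]
    linear_combination (sform (ξ₁ *ᵥ v) (ξ₂ *ᵥ v)) * hc
  simp only [preForm, Matrix.add_mul, Matrix.trace_add, trace_symSq_mul_of_skew hc h₁,
    trace_symSq_mul_of_skew hc h₂, e₀]
  simp only [Matrix.mul_add, Matrix.sub_mul, Matrix.mul_sub, Matrix.trace_add,
    Matrix.trace_sub, Matrix.mul_assoc, cyc, sform_add_left, sform_add_right,
    sform_comm w₁ (ξ₂ *ᵥ v)]
  ring

/-- Moving `b` across the form reduces to `⟨dv, v⟩` with `d = sadj b * a`. The self-adjoint part of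
`d` contributes nothing, because the form is alternating up to the invertible 2, so the hypothesis
on skew elements suffices. -/
theorem sform_mulVec_mulVec_mem {c : S} (hc : 2 * c = 1) (O : Subring S)
    (A : Subring (Matrix (l ⊕ l) (l ⊕ l) S)) (hA : ∀ a ∈ A, sadj a ∈ A) {v : l ⊕ l → S}
    (hv : ∀ a ∈ A, sadj a = -a → c * sform (a *ᵥ v) v ∈ O)
    {a b : Matrix (l ⊕ l) (l ⊕ l) S} (ha : a ∈ A) (hb : b ∈ A) :
    sform (a *ᵥ v) (b *ᵥ v) ∈ O := by
  set d := sadj b * a with hd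
  have hdA : d ∈ A := mul_mem (hA b hb) ha
  have e : sform (a *ᵥ v) (b *ᵥ v) = sform (d *ᵥ v) v := by
    rw [hd, ← Matrix.mulVec_mulVec, sform_mulVec (sadj b), sadj_sadj]
  have e' : sform (sadj d *ᵥ v) v = -sform (d *ᵥ v) v := by
    rw [sform_mulVec, sadj_sadj, sform_comm]
  have h := hv (d - sadj d) (sub_mem hdA (hA d hdA)) (by rw [sadj_sub, sadj_sadj, neg_sub])
  rw [Matrix.sub_mulVec, sform_sub_left, e'] at h
  rw [e]
  convert h using 1
  linear_combination (-sform (d *ᵥ v) v) * hc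

end SymplecticAlgebra

/-! ### Integral Laurent series and matrices; the residue. -/

section Laurent

variable {n : ℕ} {R : Type} [CommRing R]

/-- The subring `R[[t]]` of `R((t))`. -/
def arcRing (R : Type) [CommRing R] : Subring (LaurentSeries R) :=
  (HahnSeries.ofPowerSeries ℤ R).range

theorem mem_arcRing_iff {f : LaurentSeries R} :
    f ∈ arcRing R ↔ ∀ m : ℤ, m < 0 → f.coeff m = 0 := by
  constructor
  · rintro ⟨p, rfl⟩ m hm
    rw [PowerSeries.coeff_coe, if_pos hm]
  · intro h
    refine ⟨PowerSeries.mk fun k => f.coeff k, ?_⟩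
    ext m
    rw [PowerSeries.coeff_coe]
    split_ifs with hm
    · rw [h m hm]
    · rw [PowerSeries.coeff_mk, Int.natAbs_of_nonneg (not_lt.mp hm)]

theorem C_mem_arcRing (c : R) : HahnSeries.C c ∈ arcRing R :=
  ⟨PowerSeries.C c, HahnSeries.ofPowerSeries_C c⟩

theorem res_add (f g : LaurentSeries R) : res (f + g) = res f + res g := rfl

theorem res_neg (f : LaurentSeries R) : res (-f) = -res f := rfl

theorem res_C_mul (c : R) (f : LaurentSeries R) : res (HahnSeries.C c * f) = c * res f := by
  rw [HahnSeries.C_mul_eq_smul]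
  rfl

theorem res_eq_zero {f : LaurentSeries R} (hf : f ∈ arcRing R) : res f = 0 :=
  mem_arcRing_iff.mp hf (-1) (by norm_num)

/-- Multiplying by `t^(-1-m)`, which is integral for `m < 0`, moves the coefficient of index `m`
into the residue. -/
theorem mem_arcRing_of_res {f : LaurentSeries R} (h : ∀ g ∈ arcRing R, res (f * g) = 0) :
    f ∈ arcRing R := by
  rw [mem_arcRing_iff]
  intro m hm
  have hg : (HahnSeries.single (-1 - m) (1 : R) : LaurentSeries R) ∈ arcRing R := by
    rw [mem_arcRing_iff]
    intro k hk
    exact HahnSeries.coeff_single_of_ne (by omega)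
  have e : (f * HahnSeries.single (-1 - m) (1 : R)).coeff (m + (-1 - m)) = f.coeff m := by
    rw [HahnSeries.coeff_mul_single_add, mul_one]
  rw [← e, add_sub_cancel]
  exact h _ hg

/-- `R[[t]]`-valued matrices. -/
abbrev arcMat (n : ℕ) (R : Type) [CommRing R] : Subring (Mat n R) := (arcRing R).matrix

theorem mem_spO_iff {A : Mat n R} : A ∈ spO n R ↔ sadj A = -A ∧ A ∈ arcMat n R := by
  have h : A ∈ arcMat n R ↔ ∀ i j, ∀ m : ℤ, m < 0 → (A i j).coeff m = 0 :=
    forall₂_congr fun i j => mem_arcRing_iff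
  rw [h, ← mem_sp_iff]
  rfl

theorem transpose_mem_arcMat {A : Mat n R} (hA : A ∈ arcMat n R) : Aᵀ ∈ arcMat n R :=
  fun i j => hA j i

theorem J_mem_arcMat : Matrix.J (Fin n) (LaurentSeries R) ∈ arcMat n R := by
  rintro (i | i) (j | j) <;> simp [Matrix.J, Matrix.one_apply] <;> split_ifs <;>
    simp [zero_mem, one_mem]

theorem sadj_mem_arcMat {A : Mat n R} (hA : A ∈ arcMat n R) : sadj A ∈ arcMat n R :=
  neg_mem (mul_mem (mul_mem J_mem_arcMat (transpose_mem_arcMat hA)) J_mem_arcMat)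

theorem trace_mem_arcRing {A : Mat n R} (hA : A ∈ arcMat n R) : A.trace ∈ arcRing R :=
  sum_mem fun i _ => hA i i

theorem smul_mem_arcMat {c : LaurentSeries R} (hc : c ∈ arcRing R) {A : Mat n R}
    (hA : A ∈ arcMat n R) : c • A ∈ arcMat n R :=
  fun i j => (arcRing R).mul_mem hc (hA i j)

end Laurent

/-! ### Ring homomorphisms and derivations applied to coefficients. -/

section CoefficientMaps

variable {n : ℕ} {R S : Type} [CommRing R] [Algebra ℂ R] [CommRing S] [Algebra ℂ S]

/-- `φ` is a ring homomorphism and `δ` is a derivation over it. -/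
structure IsDerivationOver (φ δ : R →ₗ[ℂ] S) : Prop where
  map_one : φ 1 = 1
  map_mul : ∀ a b, φ (a * b) = φ a * φ b
  leibniz : ∀ a b, δ (a * b) = φ a * δ b + δ a * φ b

theorem IsDerivationOver.map_one_eq_zero {φ δ : R →ₗ[ℂ] S} (h : IsDerivationOver φ δ) :
    δ 1 = 0 := by
  have := h.leibniz 1 1
  rw [mul_one, h.map_one, one_mul, mul_one] at this
  simpa using this

/-- A linear map applied to the coefficients of a Laurent series. -/
def mapLaurent (δ : R →ₗ[ℂ] S) : LaurentSeries R →+ LaurentSeries S where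
  toFun f := HahnSeries.map f δ
  map_zero' := by ext; simp
  map_add' f g := by ext; simp

theorem mapLaurent_coeff (δ : R →ₗ[ℂ] S) (f : LaurentSeries R) (m : ℤ) :
    (mapLaurent δ f).coeff m = δ (f.coeff m) := rfl

theorem res_mapLaurent (δ : R →ₗ[ℂ] S) (f : LaurentSeries R) :
    res (mapLaurent δ f) = δ (res f) := rfl

theorem mapLaurent_C (δ : R →ₗ[ℂ] S) (c : R) :
    mapLaurent δ (HahnSeries.C c) = HahnSeries.C (δ c) := by
  ext m
  rw [mapLaurent_coeff, HahnSeries.C_apply, HahnSeries.C_apply, HahnSeries.coeff_single,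
    HahnSeries.coeff_single]
  split_ifs <;> simp

theorem mapLaurent_mem (δ : R →ₗ[ℂ] S) {f : LaurentSeries R} (hf : f ∈ arcRing R) :
    mapLaurent δ f ∈ arcRing S := by
  rw [mem_arcRing_iff] at hf ⊢
  intro m hm
  rw [mapLaurent_coeff, hf m hm, map_zero]

theorem support_mapLaurent (δ : R →ₗ[ℂ] S) (f : LaurentSeries R) :
    (mapLaurent δ f).support ⊆ f.support := by
  intro m hm h
  exact hm (by rw [mapLaurent_coeff, h, map_zero])

variable {φ δ : R →ₗ[ℂ] S}

/-- Coefficient maps may shrink supports. Summing over the supports of `f` and `g` themselves gives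
all the product rules one common index set. -/
theorem coeff_mapLaurent_mul (α β : R →ₗ[ℂ] S) (f g : LaurentSeries R) (m : ℤ) :
    (mapLaurent α f * mapLaurent β g).coeff m =
      ∑ ij ∈ Finset.antidiagonal f.isPWO_support g.isPWO_support m,
        α (f.coeff ij.1) * β (g.coeff ij.2) := by
  rw [HahnSeries.coeff_mul]
  refine Finset.sum_subset ?_ ?_
  · intro ij h
    rw [Finset.mem_antidiagonal] at h ⊢
    exact ⟨support_mapLaurent α f h.1, support_mapLaurent β g h.2.1, h.2.2⟩
  · intro ij h h'
    rw [Finset.mem_antidiagonal] at h h'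
    by_contra hne
    exact h' ⟨left_ne_zero_of_mul hne, right_ne_zero_of_mul hne, h.2.2⟩

theorem IsDerivationOver.mapLaurent_one (h : IsDerivationOver φ δ) :
    mapLaurent φ 1 = 1 := by
  have := mapLaurent_C φ 1
  rwa [h.map_one, HahnSeries.C_one, HahnSeries.C_one] at this

theorem IsDerivationOver.mapLaurent_one' (h : IsDerivationOver φ δ) :
    mapLaurent δ 1 = 0 := by
  have := mapLaurent_C δ 1
  rwa [h.map_one_eq_zero, HahnSeries.C_one, HahnSeries.C_zero] at this

theorem IsDerivationOver.mapLaurent_mul (h : IsDerivationOver φ δ) (f g : LaurentSeries R) :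
    mapLaurent φ (f * g) = mapLaurent φ f * mapLaurent φ g := by
  ext m
  rw [mapLaurent_coeff, coeff_mapLaurent_mul, HahnSeries.coeff_mul, map_sum]
  simp only [h.map_mul]

theorem IsDerivationOver.mapLaurent_leibniz (h : IsDerivationOver φ δ) (f g : LaurentSeries R) :
    mapLaurent δ (f * g) = mapLaurent φ f * mapLaurent δ g + mapLaurent δ f * mapLaurent φ g := by
  ext m
  rw [mapLaurent_coeff, HahnSeries.coeff_add, coeff_mapLaurent_mul, coeff_mapLaurent_mul,
    HahnSeries.coeff_mul, map_sum, ← Finset.sum_add_distrib]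
  simp only [h.leibniz]

theorem mapMat_apply (δ : R →ₗ[ℂ] S) (A : Mat n R) (i j) :
    mapMat δ A i j = mapLaurent δ (A i j) := rfl

theorem mapVec_apply (δ : R →ₗ[ℂ] S) (v : Vec n R) (i) : mapVec δ v i = mapLaurent δ (v i) := rfl

theorem mapMat_add (δ : R →ₗ[ℂ] S) (A B : Mat n R) :
    mapMat δ (A + B) = mapMat δ A + mapMat δ B := by
  ext1 i j; simp [mapMat_apply]

theorem mapMat_neg (δ : R →ₗ[ℂ] S) (A : Mat n R) : mapMat δ (-A) = -mapMat δ A := by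
  ext1 i j; simp [mapMat_apply]

theorem mapMat_sub (δ : R →ₗ[ℂ] S) (A B : Mat n R) :
    mapMat δ (A - B) = mapMat δ A - mapMat δ B := by
  ext1 i j; simp [mapMat_apply]

theorem mapVec_add (δ : R →ₗ[ℂ] S) (u v : Vec n R) :
    mapVec δ (u + v) = mapVec δ u + mapVec δ v := by
  ext1 i; simp [mapVec_apply]

theorem mapMat_mem (δ : R →ₗ[ℂ] S) {A : Mat n R} (hA : A ∈ arcMat n R) :
    mapMat δ A ∈ arcMat n S :=
  fun i j => mapLaurent_mem δ (hA i j)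

namespace IsDerivationOver

variable (h : IsDerivationOver φ δ)
include h

theorem mapMat_one : mapMat φ (1 : Mat n R) = 1 := by
  ext1 i j
  rw [mapMat_apply, Matrix.one_apply, Matrix.one_apply]
  split_ifs
  · exact h.mapLaurent_one
  · exact map_zero _

theorem mapMat_mul (A B : Mat n R) : mapMat φ (A * B) = mapMat φ A * mapMat φ B := by
  ext1 i j
  simp only [mapMat_apply, Matrix.mul_apply, map_sum, h.mapLaurent_mul]

theorem mapMat_leibniz (A B : Mat n R) :
    mapMat δ (A * B) = mapMat φ A * mapMat δ B + mapMat δ A * mapMat φ B := by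
  ext1 i j
  simp only [mapMat_apply, Matrix.add_apply, Matrix.mul_apply, map_sum, h.mapLaurent_leibniz,
    Finset.sum_add_distrib]

theorem mapVec_mulVec (A : Mat n R) (v : Vec n R) :
    mapVec φ (A *ᵥ v) = mapMat φ A *ᵥ mapVec φ v := by
  ext1 i
  simp only [mapMat_apply, mapVec_apply, Matrix.mulVec, dotProduct, map_sum, h.mapLaurent_mul]

theorem mapVec_leibniz (A : Mat n R) (v : Vec n R) :
    mapVec δ (A *ᵥ v) = mapMat φ A *ᵥ mapVec δ v + mapMat δ A *ᵥ mapVec φ v := by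
  ext1 i
  simp only [mapMat_apply, mapVec_apply, Matrix.mulVec, dotProduct, map_sum, Pi.add_apply,
    h.mapLaurent_leibniz, Finset.sum_add_distrib]

theorem mapMat_J : mapMat φ (Matrix.J (Fin n) (LaurentSeries R)) = Matrix.J (Fin n) _ := by
  ext1 i j
  have h1 := h.mapLaurent_one
  rcases i with i | i <;> rcases j with j | j <;>
    simp [mapMat_apply, Matrix.J, Matrix.one_apply, apply_ite (mapLaurent φ), h1]

theorem mapMat_J' : mapMat δ (Matrix.J (Fin n) (LaurentSeries R)) = 0 := by
  ext1 i j
  have h1 := h.mapLaurent_one'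
  rcases i with i | i <;> rcases j with j | j <;>
    simp [mapMat_apply, Matrix.J, Matrix.one_apply, apply_ite (mapLaurent δ), h1]

theorem mapMat_sadj (A : Mat n R) : mapMat φ (sadj A) = sadj (mapMat φ A) := by
  rw [sadj, mapMat_neg, h.mapMat_mul, h.mapMat_mul, h.mapMat_J]
  rfl

theorem mapMat_sadj' (A : Mat n R) : mapMat δ (sadj A) = sadj (mapMat δ A) := by
  rw [sadj, mapMat_neg, h.mapMat_leibniz, h.mapMat_leibniz, h.mapMat_J, h.mapMat_J',
    Matrix.mul_zero, Matrix.zero_mul, zero_add, add_zero]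
  rfl

theorem mapMat_symSq (u v : Vec n R) :
    mapMat φ (symSq u v) = symSq (mapVec φ u) (mapVec φ v) := by
  rw [symSq, mapMat_neg, h.mapMat_mul, h.mapMat_J, symSq]
  congr 2
  ext1 i j
  simp only [mapMat_apply, mapVec_apply, Matrix.add_apply, Matrix.vecMulVec_apply, map_add,
    h.mapLaurent_mul]

theorem mapMat_symSq' (u v : Vec n R) :
    mapMat δ (symSq u v) = symSq (mapVec φ u) (mapVec δ v) + symSq (mapVec δ u) (mapVec φ v) := by
  rw [symSq, mapMat_neg, h.mapMat_leibniz, h.mapMat_J, h.mapMat_J', Matrix.mul_zero, zero_add,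
    symSq, symSq, ← neg_add, ← Matrix.add_mul]
  congr 2
  ext1 i j
  simp only [mapMat_apply, mapVec_apply, Matrix.add_apply, Matrix.vecMulVec_apply, map_add,
    h.mapLaurent_leibniz]
  ring

theorem mapMat_mem_symplecticGroup {g : Mat n R}
    (hg : g ∈ Matrix.symplecticGroup (Fin n) (LaurentSeries R)) :
    mapMat φ g ∈ Matrix.symplecticGroup (Fin n) (LaurentSeries S) := by
  apply mem_symplecticGroup_of_mul_sadj
  rw [← h.mapMat_sadj, ← h.mapMat_mul, mul_sadj_of_mem hg, h.mapMat_one]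

end IsDerivationOver

/-- The scalar `1/2`. -/
def half (R : Type) [CommRing R] [Algebra ℂ R] : LaurentSeries R :=
  HahnSeries.C (algebraMap ℂ R (1 / 2))

theorem two_mul_half : 2 * half R = 1 := by
  have : (2 : LaurentSeries R) = HahnSeries.C (algebraMap ℂ R 2) := by
    rw [map_ofNat, map_ofNat]
  rw [half, this, ← map_mul, ← map_mul]
  norm_num

theorem half_mem_arcRing : half R ∈ arcRing R := C_mem_arcRing _

theorem res_half_mul (f : LaurentSeries R) : res (half R * f) = (1 / 2 : ℂ) • res f := by
  rw [half, res_C_mul, Algebra.smul_def]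

theorem mapMat_half_smul (δ : R →ₗ[ℂ] S) (A : Mat n R) :
    mapMat δ (half R • A) = half S • mapMat δ A := by
  ext i j m
  rw [mapMat_apply, mapLaurent_coeff, Matrix.smul_apply, Matrix.smul_apply, half, half,
    smul_eq_mul, smul_eq_mul, HahnSeries.C_mul_eq_smul, HahnSeries.C_mul_eq_smul,
    HahnSeries.coeff_smul, HahnSeries.coeff_smul, smul_eq_mul, smul_eq_mul, ← Algebra.smul_def,
    ← Algebra.smul_def, map_smul]
  rfl

end CoefficientMaps

/-! ### Parahorics as skew parts of orders, and the equation of the zero level. -/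

section ZeroLevel

variable {n : ℕ} {R : Type} [CommRing R]

theorem conj_mul_conj {g : Mat n R} (hg : g ∈ Matrix.symplecticGroup (Fin n) (LaurentSeries R))
    (A B : Mat n R) : sadj g * A * g * (sadj g * B * g) = sadj g * (A * B) * g := by
  simp only [Matrix.mul_assoc]
  rw [← Matrix.mul_assoc g (sadj g), mul_sadj_of_mem hg, Matrix.one_mul]

/-- The order `Ad_g` of the `R[[t]]`-valued matrices. -/
def parRing {g : Mat n R} (hg : g ∈ Matrix.symplecticGroup (Fin n) (LaurentSeries R)) :
    Subring (Mat n R) where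
  carrier := {A | sadj g * A * g ∈ arcMat n R}
  mul_mem' {A B} hA hB := by
    change sadj g * (A * B) * g ∈ arcMat n R
    rw [← conj_mul_conj hg]
    exact mul_mem hA hB
  one_mem' := by
    change sadj g * 1 * g ∈ arcMat n R
    rw [mul_one, sadj_mul_of_mem hg]
    exact one_mem _
  add_mem' {A B} hA hB := by
    change sadj g * (A + B) * g ∈ arcMat n R
    rw [mul_add, add_mul]
    exact add_mem hA hB
  zero_mem' := by
    change sadj g * 0 * g ∈ arcMat n R
    rw [mul_zero, zero_mul]
    exact zero_mem _
  neg_mem' {A} hA := by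
    change sadj g * -A * g ∈ arcMat n R
    rw [mul_neg, neg_mul]
    exact neg_mem hA

variable {g : Mat n R} (hg : g ∈ Matrix.symplecticGroup (Fin n) (LaurentSeries R))

theorem mem_parRing {A : Mat n R} : A ∈ parRing hg ↔ sadj g * A * g ∈ arcMat n R := Iff.rfl

theorem conj_mem_parRing {A : Mat n R} (hA : A ∈ arcMat n R) : g * A * sadj g ∈ parRing hg := by
  have : sadj g * (g * A * sadj g) * g = (sadj g * g) * A * (sadj g * g) := by
    simp only [Matrix.mul_assoc]
  rw [mem_parRing, this, sadj_mul_of_mem hg, one_mul, mul_one]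
  exact hA

theorem conj_conj (hg : g ∈ Matrix.symplecticGroup (Fin n) (LaurentSeries R)) (A : Mat n R) :
    g * (sadj g * A * g) * sadj g = A := by
  have : g * (sadj g * A * g) * sadj g = (g * sadj g) * A * (g * sadj g) := by
    simp only [Matrix.mul_assoc]
  rw [this, mul_sadj_of_mem hg, one_mul, mul_one]

theorem sadj_mem_parRing {A : Mat n R} (hA : A ∈ parRing hg) : sadj A ∈ parRing hg := by
  have := sadj_mem_arcMat (mem_parRing hg |>.mp hA)
  rwa [sadj_mul, sadj_mul, sadj_sadj, ← Matrix.mul_assoc] at this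

theorem trace_mem_of_parRing {A : Mat n R} (hA : A ∈ parRing hg) : A.trace ∈ arcRing R := by
  have h := trace_mem_arcRing (mem_parRing hg |>.mp hA)
  rwa [Matrix.trace_mul_comm, ← Matrix.mul_assoc, mul_sadj_of_mem hg, one_mul] at h

theorem smul_mem_parRing {c : LaurentSeries R} (hc : c ∈ arcRing R) {A : Mat n R}
    (hA : A ∈ parRing hg) : c • A ∈ parRing hg := by
  rw [mem_parRing, Matrix.mul_smul, Matrix.smul_mul]
  exact smul_mem_arcMat hc hA

theorem mem_parahoric_iff {A : Mat n R} :
    A ∈ parahoric g ↔ sadj A = -A ∧ A ∈ parRing hg := by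
  constructor
  · rintro ⟨b, hb, rfl⟩
    rw [mem_spO_iff] at hb
    rw [inv_eq_sadj hg]
    refine ⟨?_, conj_mem_parRing hg hb.2⟩
    rw [sadj_mul, sadj_mul, sadj_sadj, hb.1, Matrix.neg_mul, Matrix.mul_neg, Matrix.mul_assoc]
  · rintro ⟨h, h'⟩
    refine ⟨sadj g * A * g, mem_spO_iff.mpr ⟨?_, h'⟩, ?_⟩
    · rw [sadj_mul, sadj_mul, sadj_sadj, h, Matrix.neg_mul, Matrix.mul_neg, Matrix.mul_assoc]
    · rw [inv_eq_sadj hg, conj_conj hg]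

theorem mem_arcMat_of_res {A : Mat n R} (h : ∀ B ∈ arcMat n R, res (A * B).trace = 0) :
    A ∈ arcMat n R := by
  intro i j
  refine mem_arcRing_of_res fun f hf => ?_
  have hB : Matrix.single j i f ∈ arcMat n R := by
    intro k l
    rw [Matrix.single_apply]
    split_ifs
    · exact hf
    · exact (arcRing R).zero_mem
  have := h _ hB
  rwa [Matrix.trace_mul_comm, Matrix.trace_single_mul, smul_eq_mul, mul_comm] at this

theorem trace_mul_sadj {A : Mat n R} (hA : sadj A = -A) (B : Mat n R) :
    (A * sadj B).trace = -(A * B).trace := by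
  rw [← trace_sadj, sadj_mul, sadj_sadj, hA, Matrix.mul_neg, Matrix.trace_neg,
    Matrix.trace_mul_comm]

theorem sadj_x (z : Point n R) : sadj z.x = -z.x := mem_sp_iff.mp z.x_mem.1

variable [Algebra ℂ R]

theorem sadj_half_smul_sub (B : Mat n R) :
    sadj (half R • (B - sadj B)) = -(half R • (B - sadj B)) := by
  rw [sadj_smul, sadj_sub, sadj_sadj, ← smul_neg, neg_sub]

/-- Self-adjoint matrices are orthogonal to skew ones. This passes between tests against `sp` and
tests against a full matrix order, where lattice arguments are simpler. -/
theorem trace_mul_skewPart {A : Mat n R} (hA : sadj A = -A) (B : Mat n R) :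
    (A * half R • (B - sadj B)).trace = (A * B).trace := by
  rw [Matrix.mul_smul, Matrix.trace_smul, Matrix.mul_sub, Matrix.trace_sub, trace_mul_sadj hA,
    smul_eq_mul]
  linear_combination (A * B).trace * two_mul_half (R := R)

theorem eq_skewPart {A : Mat n R} (hA : sadj A = -A) : A = half R • (A - sadj A) := by
  rw [hA, sub_neg_eq_add, ← two_smul (LaurentSeries R) A, smul_smul, mul_comm, two_mul_half,
    one_smul]

theorem mem_arcMat_iff_of_skew {A : Mat n R} (hA : sadj A = -A) :
    A ∈ arcMat n R ↔ ∀ B ∈ spO n R, res (A * B).trace = 0 := by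
  constructor
  · intro h B hB
    exact res_eq_zero (trace_mem_arcRing (mul_mem h (mem_spO_iff.mp hB).2))
  · refine fun h => mem_arcMat_of_res fun B hB => ?_
    rw [← trace_mul_skewPart hA]
    exact h _ (mem_spO_iff.mpr ⟨sadj_half_smul_sub B,
      smul_mem_arcMat half_mem_arcRing (sub_mem hB (sadj_mem_arcMat hB))⟩)

-- Conjugation by `g` reduces this to `g_O`, which is its own annihilator by
-- `mem_arcMat_iff_of_skew`.
include hg in
theorem annihilator_parahoric : annihilator (parahoric g) = parahoric g := by
  ext x
  rw [mem_parahoric_iff hg]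
  change x ∈ spF n R ∧ _ ↔ _
  rw [mem_sp_iff]
  refine and_congr_right fun hx => ?_
  have hsk : sadj (sadj g * x * g) = -(sadj g * x * g) := by
    rw [sadj_mul, sadj_mul, sadj_sadj, hx, Matrix.neg_mul, Matrix.mul_neg, Matrix.mul_assoc]
  rw [mem_parRing, mem_arcMat_iff_of_skew hsk]
  have e (b : Mat n R) : (x * (g * b * sadj g)).trace = (sadj g * x * g * b).trace := by
    rw [← Matrix.mul_assoc, Matrix.trace_mul_comm, ← Matrix.mul_assoc, ← Matrix.mul_assoc]
  constructor
  · intro h b hb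
    rw [← e]
    exact h _ ⟨b, hb, by rw [inv_eq_sadj hg]⟩
  · rintro h _ ⟨b, hb, rfl⟩
    rw [inv_eq_sadj hg, trPairing, e]
    exact h b hb

/-- `v ↦ q(v)`, the moment map of `V_F` as a matrix. -/
def quad (v : Vec n R) : Mat n R := half R • half R • symSq v v

theorem sadj_quad (v : Vec n R) : sadj (quad v) = -quad v := by
  rw [quad, sadj_smul, sadj_smul, sadj_symSq, smul_neg, smul_neg]

theorem trace_quad_mul {ξ : Mat n R} (hξ : sadj ξ = -ξ) (v : Vec n R) :
    (quad v * ξ).trace = half R * sform (ξ *ᵥ v) v := by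
  rw [quad, Matrix.smul_mul, Matrix.trace_smul, trace_symSq_mul_of_skew two_mul_half hξ,
    smul_eq_mul]

theorem quad_mulVec (k : Mat n R) (v : Vec n R) : quad (k *ᵥ v) = k * quad v * sadj k := by
  rw [quad, quad, symSq_mulVec_mulVec, Matrix.mul_smul, Matrix.mul_smul, Matrix.smul_mul,
    Matrix.smul_mul]

/-- The trace pairing represents the moment map by `x + quad v`, and a skew matrix that annihilates
`g_O` is integral. Of the two halves in `quad`, one is that of the moment map and the other offsets
the two equal terms of `symSq v v`. -/
theorem mem_zeroLevel_iff (z : Point n R) :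
    z ∈ zeroLevel n R ↔ z.x + quad z.v ∈ arcMat n R := by
  have hsk : sadj (z.x + quad z.v) = -(z.x + quad z.v) := by
    rw [sadj_add, sadj_x, sadj_quad, neg_add]
  have hm (ξ : spO n R) : moment z ξ = res ((z.x + quad z.v) * ξ.1).trace := by
    rw [Matrix.add_mul, Matrix.trace_add, trace_quad_mul (mem_spO_iff.mp ξ.2).1, res_add,
      res_half_mul, add_comm (res _)]
    rfl
  rw [mem_arcMat_iff_of_skew hsk]
  change moment z = 0 ↔ _
  constructor
  · intro h B hB
    have := hm ⟨B, hB⟩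
    rw [h] at this
    exact this.symm
  · intro h
    ext ξ
    rw [hm ξ, h ξ.1 ξ.2]
    rfl

end ZeroLevel

/-! ### Elementary divisors. -/

section Smith

/-- The elementary divisor theorem for an invertible matrix over the fraction field of a principal
ideal domain. -/
theorem exists_smith {ι O F : Type*} [Fintype ι] [DecidableEq ι] [CommRing O] [IsDomain O]
    [IsPrincipalIdealRing O] [Field F] [Algebra O F] [IsFractionRing O F]
    (g : Matrix ι ι F) (hg : g.det ≠ 0) :
    ∃ (k k' h h' : Matrix ι ι O) (d : ι → F), k * k' = 1 ∧ h * h' = 1 ∧ (∀ i, d i ≠ 0) ∧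
      g = k.map (algebraMap O F) * Matrix.diagonal d * h.map (algebraMap O F) := by
  -- Clear denominators: `G = b g` is integral, and its range is a submodule of full rank, to which
  -- Smith normal form applies.
  obtain ⟨b, hb⟩ := IsLocalization.exist_integer_multiples_of_finite (nonZeroDivisors O)
    (fun p : ι × ι => g p.1 p.2)
  choose g₀ hg₀ using hb
  have hbF : algebraMap O F b ≠ 0 :=
    IsFractionRing.to_map_ne_zero_of_mem_nonZeroDivisors b.2
  set G : Matrix ι ι O := fun i j => g₀ (i, j) with hG
  have hGg : G.map (algebraMap O F) = algebraMap O F b • g := by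
    ext i j
    rw [Matrix.map_apply, Matrix.smul_apply, hG, hg₀, Algebra.smul_def, smul_eq_mul]
  have hGdet : G.det ≠ 0 := by
    intro h
    have h1 : (G.map (algebraMap O F)).det = 0 := by
      rw [← RingHom.mapMatrix_apply, ← RingHom.map_det, h, map_zero]
    rw [hGg, Matrix.det_smul] at h1
    exact mul_ne_zero (pow_ne_zero _ hbF) hg h1
  have hinj : Function.Injective G.mulVecLin :=
    Matrix.mulVec_injective_of_det_ne_zero hGdet
  let e := LinearEquiv.ofInjective G.mulVecLin hinj
  obtain ⟨b', a, c, hc⟩ := Submodule.exists_smith_normal_form_of_rank_eq (Pi.basisFun O ι)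
    (N := LinearMap.range G.mulVecLin) e.finrank_eq.symm
  -- The adapted basis of the range is pulled back through `G`; in the bases `c'` and `b'` the
  -- matrix of `G` is diagonal.
  let c' := c.map e.symm
  let k := (Pi.basisFun O ι).toMatrix b'
  let h := (Pi.basisFun O ι).toMatrix c'
  have hG' (j : ι) : G *ᵥ c' j = a j • b' j := by
    rw [← hc j]
    exact congrArg Subtype.val (e.apply_symm_apply (c j))
  have hGh : G * h = k * Matrix.diagonal a := by
    ext i j
    rw [Matrix.mul_diagonal]
    have := congrFun (hG' j) i
    simp only [Pi.smul_apply, smul_eq_mul] at this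
    rw [show k i j = b' j i from rfl, mul_comm, ← this]
    rfl
  have ha (j : ι) : a j ≠ 0 := by
    intro h0
    have := c.ne_zero j
    exact this (Subtype.ext (by rw [hc, h0, zero_smul]; rfl))
  have hk' : k * b'.toMatrix (Pi.basisFun O ι) = 1 :=
    Module.Basis.toMatrix_mul_toMatrix_flip _ _
  have hh' : h * c'.toMatrix (Pi.basisFun O ι) = 1 :=
    Module.Basis.toMatrix_mul_toMatrix_flip _ _
  refine ⟨k, _, c'.toMatrix (Pi.basisFun O ι), h, fun i => algebraMap O F (a i) / algebraMap O F b,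
    hk', mul_eq_one_comm.mp hh', fun i => div_ne_zero
      ((map_ne_zero_iff _ (IsFractionRing.injective O F)).mpr (ha i)) hbF, ?_⟩
  have hGe : G = k * Matrix.diagonal a * c'.toMatrix (Pi.basisFun O ι) := by
    rw [← hGh, Matrix.mul_assoc, hh', Matrix.mul_one]
  have hd : Matrix.diagonal (fun i => algebraMap O F (a i) / algebraMap O F b) =
      (algebraMap O F b)⁻¹ • (Matrix.diagonal a).map (algebraMap O F) := by
    rw [Matrix.diagonal_map (map_zero _), ← Matrix.diagonal_smul]
    congr 1
    ext i
    simp [div_eq_inv_mul]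
  rw [hd, Matrix.mul_smul, Matrix.smul_mul, ← Matrix.map_mul, ← Matrix.map_mul, ← hGe, hGg,
    smul_smul, inv_mul_cancel₀ hbF, one_smul]

end Smith

/-! ### Extension of derivations to the fraction field. -/

section ExtendDerivation

/-- A derivation of an integral domain extends to its field of fractions. -/
theorem exists_extend_derivation {R K : Type} [CommRing R] [IsDomain R] [Algebra ℂ R] [Field K]
    [Algebra R K] [IsFractionRing R K] [Algebra ℂ K] [IsScalarTower ℂ R K]
    (D : Derivation ℂ R R) :
    ∃ δ : K →ₗ[ℂ] K, IsDerivationOver LinearMap.id δ ∧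
      ∀ r, δ (algebraMap R K r) = algebraMap R K (D r) := by
  -- A derivation is a ring homomorphism to the dual numbers over the given map. Nonzero elements
  -- become units there, so localization extends it without an explicit quotient rule.
  let ψ : R →+* TrivSqZeroExt K K :=
    { toFun := fun r => (algebraMap R K r, algebraMap R K (D r))
      map_one' := by
        refine TrivSqZeroExt.ext (map_one _) ?_
        change algebraMap R K (D 1) = 0
        rw [D.map_one_eq_zero, map_zero]
      map_mul' := fun a b => by
        refine TrivSqZeroExt.ext (map_mul _ a b) ?_
        change algebraMap R K (D (a * b)) = algebraMap R K a • algebraMap R K (D b) +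
          MulOpposite.op (algebraMap R K b) • algebraMap R K (D a)
        rw [D.leibniz, map_add, smul_eq_mul, smul_eq_mul, map_mul, map_mul, smul_eq_mul,
          MulOpposite.smul_eq_mul_unop, MulOpposite.unop_op, mul_comm (algebraMap R K b)]
      map_zero' := by
        refine TrivSqZeroExt.ext (map_zero _) ?_
        change algebraMap R K (D 0) = 0
        rw [map_zero, map_zero]
      map_add' := fun a b => by
        refine TrivSqZeroExt.ext (map_add _ a b) ?_
        change algebraMap R K (D (a + b)) = algebraMap R K (D a) + algebraMap R K (D b)
        rw [map_add, map_add] }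
  have hψ (r : R) : (ψ r).fst = algebraMap R K r := rfl
  have hψ' (r : R) : (ψ r).snd = algebraMap R K (D r) := rfl
  have hu : ∀ y : nonZeroDivisors R, IsUnit (ψ y) := by
    intro y
    rw [TrivSqZeroExt.isUnit_iff_isUnit_fst]
    rw [hψ]
    exact IsLocalization.map_units K y
  let Ψ : K →+* TrivSqZeroExt K K := IsLocalization.lift hu
  have hΨ (r : R) : Ψ (algebraMap R K r) = ψ r := IsLocalization.lift_eq hu r
  have hfst : ∀ a : K, (Ψ a).fst = a := by
    have : (TrivSqZeroExt.fstHom K K K : TrivSqZeroExt K K →+* K).comp Ψ = RingHom.id K := by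
      apply IsLocalization.ringHom_ext (nonZeroDivisors R)
      ext r
      simp [hΨ, hψ]
    exact fun a => RingHom.congr_fun this a
  have hmul (a b : K) : (Ψ (a * b)).snd = a * (Ψ b).snd + (Ψ a).snd * b := by
    rw [map_mul, TrivSqZeroExt.snd_mul, hfst, hfst]
    simp [mul_comm]
  have hconst (c : ℂ) : (Ψ (algebraMap ℂ K c)).snd = 0 := by
    rw [IsScalarTower.algebraMap_apply ℂ R K, hΨ, hψ', D.map_algebraMap, map_zero]
  refine ⟨{ toFun := fun a => (Ψ a).snd, map_add' := fun a b => by simp, map_smul' := fun c a => ?_ },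
    ⟨rfl, fun _ _ => rfl, hmul⟩, fun r => ?_⟩
  · rw [Algebra.smul_def, hmul, hconst, zero_mul, add_zero, RingHom.id_apply, Algebra.smul_def]
  · change (Ψ (algebraMap R K r)).snd = _
    rw [hΨ, hψ']

end ExtendDerivation

/-! ### Logarithmic derivatives of families of lattices over a field. -/

section FieldDerivation

variable {n : ℕ} {K : Type} [Field K] [Algebra ℂ K]

/-- A coefficientwise map cannot enlarge the support, and over a field the orders of `f` and `f⁻¹`
add up to zero. -/
theorem mapLaurent_mul_inv_mem (δ : K →ₗ[ℂ] K) (f : LaurentSeries K) :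
    mapLaurent δ f * f⁻¹ ∈ arcRing K := by
  rcases eq_or_ne f 0 with rfl | hf
  · rw [map_zero, zero_mul]
    exact zero_mem _
  rw [mem_arcRing_iff]
  intro m hm
  have ho : f.order + f⁻¹.order = 0 := by
    rw [← HahnSeries.order_mul hf (inv_ne_zero hf), mul_inv_cancel₀ hf, HahnSeries.order_one]
  rw [HahnSeries.coeff_mul]
  refine Finset.sum_eq_zero fun ij hij => ?_
  rw [Finset.mem_antidiagonal] at hij
  have h1 := HahnSeries.order_le_of_coeff_ne_zero (support_mapLaurent δ f hij.1)
  have h2 := HahnSeries.order_le_of_coeff_ne_zero hij.2.1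
  have h3 := hij.2.2
  omega

theorem mapMat_id {R : Type} [CommRing R] [Algebra ℂ R] (A : Mat n R) :
    mapMat (LinearMap.id : R →ₗ[ℂ] R) A = A := rfl

theorem mapVec_id {R : Type} [CommRing R] [Algebra ℂ R] (v : Vec n R) :
    mapVec (LinearMap.id : R →ₗ[ℂ] R) v = v := rfl

variable {δ : K →ₗ[ℂ] K} (hδ : IsDerivationOver LinearMap.id δ)
  {g : Mat n K} (hg : g ∈ Matrix.symplecticGroup (Fin n) (LaurentSeries K))
include hδ

/-- Differentiate `g * sadj g = 1`. -/
theorem sadj_logDeriv (hg : g ∈ Matrix.symplecticGroup (Fin n) (LaurentSeries K)) :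
    sadj (mapMat δ g * g⁻¹) = -(mapMat δ g * g⁻¹) := by
  have h := hδ.mapMat_leibniz g (sadj g)
  have h1 : mapMat δ (1 : Mat n K) = 0 := by
    ext1 i j
    rw [mapMat_apply, Matrix.one_apply]
    split_ifs
    · exact hδ.mapLaurent_one'
    · exact map_zero _
  rw [mul_sadj_of_mem hg, h1, mapMat_id, mapMat_id, hδ.mapMat_sadj'] at h
  rw [inv_eq_sadj hg, sadj_mul, sadj_sadj]
  exact eq_neg_of_add_eq_zero_left h.symm

/-- The logarithmic derivative of a family of lattices splits into a part preserving the standard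
lattice and a part preserving the moving one. -/
theorem exists_split_logDeriv_aux (v : Vec n K) :
    ∃ ξ β α : Mat n K, mapMat δ g * g⁻¹ = ξ + β ∧ ξ ∈ arcMat n K ∧ β ∈ parRing hg ∧
      α ∈ arcMat n K ∧ α ∈ parRing hg ∧ mapVec δ v = ξ *ᵥ v + α *ᵥ v := by
  have hdet : g.det ≠ 0 := (SymplecticGroup.symplectic_det hg).ne_zero
  -- From `g = k D h`, `(δg)g⁻¹` is the sum of `(δk)k⁻¹`, `k(δD)D⁻¹k⁻¹` and `kD(δh)h⁻¹D⁻¹k⁻¹`. The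
  -- first term is `ξ`; the other two lie in the moving order and form `β`. The factors need not be
  -- symplectic, so `ξ` and `β` need not be skew.
  obtain ⟨k₀, k₀', h₀, h₀', d, hk₀, hh₀, hd, hg₀⟩ :=
    exists_smith (O := PowerSeries K) g hdet
  have hmem (A : Matrix (Fin n ⊕ Fin n) (Fin n ⊕ Fin n) (PowerSeries K)) :
      A.map (algebraMap (PowerSeries K) (LaurentSeries K)) ∈ arcMat n K := fun i j => ⟨A i j, rfl⟩
  have hmap {A B : Matrix (Fin n ⊕ Fin n) (Fin n ⊕ Fin n) (PowerSeries K)} (h : A * B = 1) :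
      A.map (algebraMap (PowerSeries K) (LaurentSeries K)) *
        B.map (algebraMap (PowerSeries K) (LaurentSeries K)) = 1 := by
    rw [← Matrix.map_mul, h, Matrix.map_one _ (map_zero _) (map_one _)]
  obtain ⟨k, k', h, h', hk, hk', hh, hh', hkk, hhh, hgk⟩ :
      ∃ k k' h h' : Mat n K, k ∈ arcMat n K ∧ k' ∈ arcMat n K ∧ h ∈ arcMat n K ∧ h' ∈ arcMat n K ∧
        k * k' = 1 ∧ h * h' = 1 ∧ g = k * Matrix.diagonal d * h :=
    ⟨_, _, _, _, hmem k₀, hmem k₀', hmem h₀, hmem h₀', hmap hk₀, hmap hh₀, hg₀⟩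
  have hkk' : k' * k = 1 := mul_eq_one_comm.mp hkk
  have hhh' : h' * h = 1 := mul_eq_one_comm.mp hhh
  set D : Mat n K := Matrix.diagonal d with hD
  set E : Mat n K := Matrix.diagonal (fun i => (d i)⁻¹) with hE
  have hDE : D * E = 1 := by
    rw [hD, hE, Matrix.diagonal_mul_diagonal, ← Matrix.diagonal_one]
    congr 1
    ext1 i
    exact mul_inv_cancel₀ (hd i)
  have hED : E * D = 1 := mul_eq_one_comm.mp hDE
  have hginv : g⁻¹ = h' * E * k' := by
    apply Matrix.inv_eq_right_inv
    calc g * (h' * E * k') = k * D * (h * h') * E * k' := by rw [hgk]; simp only [Matrix.mul_assoc]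
      _ = k * (D * E) * k' := by rw [hhh, Matrix.mul_one, Matrix.mul_assoc k]
      _ = 1 := by rw [hDE, Matrix.mul_one, hkk]
  have hpar {A : Mat n K} : A ∈ parRing hg ↔ h' * E * k' * A * k * D * h ∈ arcMat n K := by
    rw [mem_parRing, ← inv_eq_sadj hg, hginv]
    conv_lhs => rw [hgk]
    simp only [Matrix.mul_assoc]
  have hdiag {c : Fin n ⊕ Fin n → LaurentSeries K} (hc : ∀ i, c i ∈ arcRing K) :
      (Matrix.diagonal c : Mat n K) ∈ arcMat n K :=
    (Matrix.diagonal_mem_matrix_iff (arcRing K).zero_mem).mpr hc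
  have hpar_diag {c : Fin n ⊕ Fin n → LaurentSeries K} (hc : ∀ i, c i ∈ arcRing K) :
      k * Matrix.diagonal c * k' ∈ parRing hg := by
    rw [hpar]
    have : h' * E * k' * (k * Matrix.diagonal c * k') * k * D * h =
        h' * E * (k' * k) * Matrix.diagonal c * (k' * k) * D * h := by
      simp only [Matrix.mul_assoc]
    rw [this, hkk', Matrix.mul_one, Matrix.mul_one, Matrix.mul_assoc h', Matrix.mul_assoc h',
      hE, hD, Matrix.diagonal_mul_diagonal, Matrix.diagonal_mul_diagonal]
    refine mul_mem (mul_mem hh' (hdiag fun i => ?_)) hh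
    rw [mul_right_comm, inv_mul_cancel₀ (hd i), one_mul]
    exact hc i
  have hδD : mapMat δ D = Matrix.diagonal (fun i => mapLaurent δ (d i)) := by
    ext1 i j
    rw [mapMat_apply, hD, Matrix.diagonal_apply, Matrix.diagonal_apply]
    split_ifs <;> simp
  set v' := k' *ᵥ v with hv'
  -- A diagonal integral matrix commutes with `D`, so its conjugate by `k` preserves both lattices.
  -- Where a coordinate vanishes, so does its derivative, and the junk value `0⁻¹ = 0` is correct.
  set c : Fin n ⊕ Fin n → LaurentSeries K := fun i => mapLaurent δ (v' i) * (v' i)⁻¹ with hc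
  have hcO (i) : c i ∈ arcRing K := mapLaurent_mul_inv_mem δ _
  have hδv' : mapVec δ v' = Matrix.diagonal c *ᵥ v' := by
    ext1 i
    rw [Matrix.mulVec_diagonal, mapVec_apply, hc]
    rcases eq_or_ne (v' i) 0 with h0 | h0
    · rw [h0, map_zero, mul_zero]
    · rw [mul_assoc, inv_mul_cancel₀ h0, mul_one]
  refine ⟨mapMat δ k * k', k * mapMat δ D * E * k' + k * D * mapMat δ h * h' * E * k',
    k * Matrix.diagonal c * k', ?_, mul_mem (mapMat_mem δ hk) hk', add_mem ?_ ?_,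
    mul_mem (mul_mem hk (hdiag hcO)) hk', hpar_diag hcO, ?_⟩
  · rw [hginv]
    conv_lhs => rw [hgk]
    rw [hδ.mapMat_leibniz, hδ.mapMat_leibniz, mapMat_id, mapMat_id, mapMat_id, mapMat_id]
    have e1 : (k * D * mapMat δ h + (k * mapMat δ D + mapMat δ k * D) * h) * (h' * E * k') =
        k * D * mapMat δ h * h' * E * k' + (k * mapMat δ D + mapMat δ k * D) * (h * h') * E * k' := by
      simp only [Matrix.add_mul, Matrix.mul_assoc]
    rw [e1, hhh, Matrix.mul_one, Matrix.add_mul, Matrix.mul_assoc (mapMat δ k), hDE, Matrix.mul_one,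
      Matrix.add_mul]
    abel
  · rw [hδD, hE, Matrix.mul_assoc k, Matrix.diagonal_mul_diagonal]
    exact hpar_diag fun i => mapLaurent_mul_inv_mem δ _
  · rw [hpar]
    have : h' * E * k' * (k * D * mapMat δ h * h' * E * k') * k * D * h =
        h' * (E * ((k' * k) * D)) * mapMat δ h * h' * (E * ((k' * k) * D)) * h := by
      simp only [Matrix.mul_assoc]
    rw [this, hkk', Matrix.one_mul, hED, Matrix.mul_one, Matrix.mul_one]
    exact mul_mem (mul_mem (mul_mem hh' (mapMat_mem δ hh)) hh') hh
  · have e : v = k *ᵥ v' := by rw [hv', Matrix.mulVec_mulVec, hkk, Matrix.one_mulVec]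
    conv_lhs => rw [e]
    rw [hδ.mapVec_leibniz, mapMat_id, mapVec_id, hδv', hv', Matrix.mulVec_mulVec,
      Matrix.mulVec_mulVec, Matrix.mulVec_mulVec, add_comm, Matrix.mul_assoc]

/-- Take skew parts of both summands. As the total is already skew, `ξ₀` and `β₀` change by opposite
amounts; this change therefore lies in both orders and is absorbed into `α`. -/
theorem exists_split_logDeriv (v : Vec n K) :
    ∃ ξ β α : Mat n K, mapMat δ g * g⁻¹ = ξ + β ∧ sadj ξ = -ξ ∧ sadj β = -β ∧
      ξ ∈ arcMat n K ∧ β ∈ parRing hg ∧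
      α ∈ arcMat n K ∧ α ∈ parRing hg ∧ mapVec δ v = ξ *ᵥ v + α *ᵥ v := by
  obtain ⟨ξ₀, β₀, α₀, h, hξ, hβ, hα, hα', hv⟩ := exists_split_logDeriv_aux hδ hg v
  have hξ' : half K • (ξ₀ - sadj ξ₀) ∈ arcMat n K :=
    smul_mem_arcMat half_mem_arcRing (sub_mem hξ (sadj_mem_arcMat hξ))
  have hβ' : half K • (β₀ - sadj β₀) ∈ parRing hg :=
    smul_mem_parRing hg half_mem_arcRing (sub_mem hβ (sadj_mem_parRing hg hβ))
  have hsplit : ξ₀ + β₀ = half K • (ξ₀ - sadj ξ₀) + half K • (β₀ - sadj β₀) := by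
    rw [← h, ← smul_add, eq_skewPart (sadj_logDeriv hδ hg), h, sadj_add]
    congr 1
    abel
  refine ⟨half K • (ξ₀ - sadj ξ₀), half K • (β₀ - sadj β₀),
    α₀ + (ξ₀ - half K • (ξ₀ - sadj ξ₀)), h.trans hsplit, sadj_half_smul_sub _,
    sadj_half_smul_sub _, hξ', hβ', add_mem hα (sub_mem hξ hξ'), ?_, ?_⟩
  · have : ξ₀ - half K • (ξ₀ - sadj ξ₀) = half K • (β₀ - sadj β₀) - β₀ := by
      rw [sub_eq_sub_iff_add_eq_add, hsplit, add_comm]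
    rw [this]
    exact add_mem hα' (sub_mem hβ' hβ)
  · rw [hv, Matrix.add_mulVec, Matrix.sub_mulVec]
    abel

end FieldDerivation

/-! ### Isotropy of the zero level. -/

section Isotropic

variable {n : ℕ} {K : Type} [Field K] [Algebra ℂ K]
  {g : Mat n K} (hg : g ∈ Matrix.symplecticGroup (Fin n) (LaurentSeries K))

/-- Write `quad v` as `(x + quad v) - x`: the first term pairs integrally with one order, the second
with the other. -/
theorem half_mul_sform_mem {R : Type} [CommRing R] [Algebra ℂ R] {g : Mat n R}
    (hg : g ∈ Matrix.symplecticGroup (Fin n) (LaurentSeries R)) {v : Vec n R} {x : Mat n R}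
    (hx : x ∈ parRing hg) (hv : x + quad v ∈ arcMat n R) {a : Mat n R}
    (ha : a ∈ arcMat n R ⊓ parRing hg) (hsk : sadj a = -a) :
    half R * sform (a *ᵥ v) v ∈ arcRing R := by
  rw [← trace_quad_mul hsk, ← add_sub_cancel_left x (quad v), Matrix.sub_mul, Matrix.trace_sub]
  exact sub_mem (trace_mem_arcRing (mul_mem hv ha.1)) (trace_mem_of_parRing hg (mul_mem hx ha.2))

/-- On the zero level, the vectors `av`, with `a` preserving both lattices, are orthogonal. -/
theorem sform_mulVec_mem {R : Type} [CommRing R] [Algebra ℂ R] {g : Mat n R}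
    (hg : g ∈ Matrix.symplecticGroup (Fin n) (LaurentSeries R)) {v : Vec n R} {x : Mat n R}
    (hx : x ∈ parRing hg) (hv : x + quad v ∈ arcMat n R) {a b : Mat n R}
    (ha : a ∈ arcMat n R ⊓ parRing hg) (hb : b ∈ arcMat n R ⊓ parRing hg) :
    sform (a *ᵥ v) (b *ᵥ v) ∈ arcRing R :=
  sform_mulVec_mulVec_mem two_mul_half (arcRing R) (arcMat n R ⊓ parRing hg)
    (fun _ h => ⟨sadj_mem_arcMat h.1, sadj_mem_parRing hg h.2⟩)
    (fun _ h h' => half_mul_sform_mem hg hx hv h h') ha hb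

theorem mapMat_quad {R S : Type} [CommRing R] [Algebra ℂ R] [CommRing S] [Algebra ℂ S]
    {φ δ : R →ₗ[ℂ] S} (h : IsDerivationOver φ δ) (v : Vec n R) :
    mapMat φ (quad v) = quad (mapVec φ v) := by
  rw [quad, mapMat_half_smul, mapMat_half_smul, h.mapMat_symSq, quad]

theorem mapMat_quad' {R S : Type} [CommRing R] [Algebra ℂ R] [CommRing S] [Algebra ℂ S]
    {φ δ : R →ₗ[ℂ] S} (h : IsDerivationOver φ δ) (v : Vec n R) :
    mapMat δ (quad v) = half S • symSq (mapVec φ v) (mapVec δ v) := by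
  rw [quad, mapMat_half_smul, mapMat_half_smul, h.mapMat_symSq',
    symSq_comm (mapVec δ v), ← two_smul (LaurentSeries S), smul_smul, smul_smul, mul_assoc,
    mul_comm _ (2 : LaurentSeries S), two_mul_half, mul_one]

theorem lie_quad {R : Type} [CommRing R] [Algebra ℂ R] {ξ : Mat n R} (hξ : sadj ξ = -ξ)
    (v : Vec n R) :
    ξ * quad v - quad v * ξ = half R • symSq v (ξ *ᵥ v) := by
  have h := symSq_mulVec_add ξ v v
  rw [symSq_comm (ξ *ᵥ v), hξ, Matrix.mul_neg, ← sub_eq_add_neg] at h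
  rw [quad, Matrix.mul_smul, Matrix.mul_smul, Matrix.smul_mul, Matrix.smul_mul, ← smul_sub,
    ← smul_sub, ← h, ← two_smul (LaurentSeries R), smul_smul, smul_smul, mul_assoc,
    mul_comm _ (2 : LaurentSeries R), two_mul_half, mul_one]

/-- The velocity of a family over a field, written as the sum of a direction of the group action,
a redundant direction and the rest. -/
theorem exists_decomposition {δ : K →ₗ[ℂ] K} (hδ : IsDerivationOver LinearMap.id δ) {v : Vec n K}
    {x : Mat n K} (hx : x ∈ parRing hg) (hv : x + quad v ∈ arcMat n K) :
    ∃ ξ β y α : Mat n K, sadj ξ = -ξ ∧ ξ ∈ arcMat n K ∧ β ∈ parRing hg ∧ y ∈ parRing hg ∧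
      α ∈ arcMat n K ⊓ parRing hg ∧ y + half K • symSq v (α *ᵥ v) ∈ arcMat n K ∧
      mapMat δ g * g⁻¹ = ξ + β ∧ mapVec δ v = ξ *ᵥ v + α *ᵥ v ∧
      mapMat δ x = ξ * x - x * ξ + y := by
  obtain ⟨ξ, β, α, ha, hξ, hβ, hξO, hβP, hα, hα', hδv⟩ := exists_split_logDeriv hδ hg v
  refine ⟨ξ, β, mapMat δ x - (ξ * x - x * ξ), α, hξ, hξO, hβP, ?_, ⟨hα, hα'⟩, ?_, ha, hδv,
    (add_sub_cancel _ _).symm⟩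
  · have hgg : g * g⁻¹ = 1 := by rw [inv_eq_sadj hg, mul_sadj_of_mem hg]
    -- Differentiate `x = g y g⁻¹` with `y` integral.
    have e : mapMat δ x = (mapMat δ g * g⁻¹) * x - x * (mapMat δ g * g⁻¹) +
        g * mapMat δ (sadj g * x * g) * sadj g := by
      have h1 := congrArg (mapMat δ) (conj_conj hg x)
      set y := sadj g * x * g with hy
      have hsk := sadj_logDeriv hδ hg
      rw [inv_eq_sadj hg, sadj_mul, sadj_sadj] at hsk
      rw [hδ.mapMat_leibniz, hδ.mapMat_leibniz, hδ.mapMat_sadj', mapMat_id, mapMat_id, mapMat_id,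
        mapMat_id] at h1
      rw [← h1, inv_eq_sadj hg]
      have e1 : x = g * y * sadj g := (conj_conj hg x).symm
      have e2 : mapMat δ g * sadj g * x = mapMat δ g * y * sadj g := by
        rw [e1]
        simp only [← Matrix.mul_assoc]
        rw [Matrix.mul_assoc _ (sadj g) g, sadj_mul_of_mem hg, Matrix.mul_one]
      have e3 : g * y * sadj (mapMat δ g) = -(x * (mapMat δ g * sadj g)) := by
        rw [← Matrix.mul_neg, ← hsk, e1]
        simp only [← Matrix.mul_assoc]
        rw [Matrix.mul_assoc _ (sadj g) g, sadj_mul_of_mem hg, Matrix.mul_one]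
      rw [e2, e3, Matrix.add_mul]
      abel
    rw [e, ha]
    have : (ξ + β) * x - x * (ξ + β) + g * mapMat δ (sadj g * x * g) * sadj g - (ξ * x - x * ξ) =
        β * x - x * β + g * mapMat δ (sadj g * x * g) * sadj g := by
      noncomm_ring
    rw [this]
    exact add_mem (sub_mem (mul_mem hβP hx) (mul_mem hx hβP))
      (conj_mem_parRing hg (mapMat_mem δ hx))
  -- The momentum `x + quad v` is integral along the family, hence so is its derivative;
  -- equivariance of `quad` (`lie_quad`) removes the contribution of `ξ`.
  · have e : mapMat δ x - (ξ * x - x * ξ) + half K • symSq v (α *ᵥ v) =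
        mapMat δ (x + quad v) - (ξ * (x + quad v) - (x + quad v) * ξ) := by
      have hl : ξ * (x + quad v) - (x + quad v) * ξ =
          (ξ * x - x * ξ) + half K • symSq v (ξ *ᵥ v) := by
        rw [← lie_quad hξ]
        noncomm_ring
      rw [mapMat_add, mapMat_quad' hδ, mapVec_id, hδv, symSq_add_right, smul_add, hl]
      abel
    rw [e]
    exact sub_mem (mapMat_mem δ hv) (sub_mem (mul_mem hξO hv) (mul_mem hv hξO))

/-- Each trace in `preForm_eq` is of a product inside one of the two orders, and the remaining term
is `⟨α₁v, α₂v⟩`. So the form is integral before the residue is taken. -/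
theorem preForm_mem {δ₁ δ₂ : K →ₗ[ℂ] K} (hδ₁ : IsDerivationOver LinearMap.id δ₁)
    (hδ₂ : IsDerivationOver LinearMap.id δ₂) {v : Vec n K} {x : Mat n K} (hx : x ∈ parRing hg)
    (hv : x + quad v ∈ arcMat n K) :
    preForm x (mapVec δ₁ v) (mapMat δ₁ g * g⁻¹) (mapMat δ₁ x)
      (mapVec δ₂ v) (mapMat δ₂ g * g⁻¹) (mapMat δ₂ x) ∈ arcRing K := by
  obtain ⟨ξ₁, β₁, y₁, α₁, hξ₁, hξ₁O, hβ₁, hy₁, hα₁, hyα₁, ea₁, ev₁, ex₁⟩ :=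
    exists_decomposition hg hδ₁ hx hv
  obtain ⟨ξ₂, β₂, y₂, α₂, hξ₂, hξ₂O, hβ₂, hy₂, hα₂, hyα₂, ea₂, ev₂, ex₂⟩ :=
    exists_decomposition hg hδ₂ hx hv
  rw [ea₁, ev₁, ex₁, ea₂, ev₂, ex₂, preForm_eq two_mul_half hξ₁ hξ₂]
  refine add_mem (sub_mem (sub_mem (add_mem (sub_mem (add_mem
    (sform_mulVec_mem hg hx hv hα₁ hα₂) (trace_mem_arcRing (mul_mem hyα₂ hξ₁O)))
    (trace_mem_arcRing (mul_mem hyα₁ hξ₂O))) (trace_mem_of_parRing hg (mul_mem hy₂ hβ₁)))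
    (trace_mem_of_parRing hg (mul_mem hy₁ hβ₂))) (trace_mem_of_parRing hg
    (mul_mem hx (sub_mem (mul_mem hβ₁ hβ₂) (mul_mem hβ₂ hβ₁)))))
    (trace_mem_arcRing (mul_mem hv (sub_mem (mul_mem hξ₁O hξ₂O) (mul_mem hξ₂O hξ₁O))))

theorem mapLaurent_trace {R S : Type} [CommRing R] [Algebra ℂ R] [CommRing S] [Algebra ℂ S]
    (φ : R →ₗ[ℂ] S) (A : Mat n R) : mapLaurent φ A.trace = (mapMat φ A).trace :=
  map_sum (mapLaurent φ) _ _

theorem mapLaurent_sform {R S : Type} [CommRing R] [Algebra ℂ R] [CommRing S] [Algebra ℂ S]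
    {φ δ : R →ₗ[ℂ] S} (h : IsDerivationOver φ δ) (u v : Vec n R) :
    mapLaurent φ (sform u v) = sform (mapVec φ u) (mapVec φ v) := by
  rw [sform, sform, ← h.mapMat_J, ← h.mapVec_mulVec, dotProduct, map_sum]
  simp only [h.mapLaurent_mul]
  rfl

theorem mapLaurent_preForm {R S : Type} [CommRing R] [Algebra ℂ R] [CommRing S] [Algebra ℂ S]
    {φ δ : R →ₗ[ℂ] S} (h : IsDerivationOver φ δ) (x : Mat n R) (w₁ w₂ : Vec n R)
    (a₁ y₁ a₂ y₂ : Mat n R) :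
    mapLaurent φ (preForm x w₁ a₁ y₁ w₂ a₂ y₂) =
      preForm (mapMat φ x) (mapVec φ w₁) (mapMat φ a₁) (mapMat φ y₁)
        (mapVec φ w₂) (mapMat φ a₂) (mapMat φ y₂) := by
  simp only [preForm, map_add, map_sub, mapLaurent_trace, mapLaurent_sform h, h.mapMat_mul,
    mapMat_sub]

theorem sympForm_eq_res {R : Type} [CommRing R] [Algebra ℂ R] (z : Point n R)
    (τ σ : Tangent n R) :
    sympForm z τ σ = res (preForm z.x τ.w τ.a τ.y σ.w σ.a σ.y) := rfl

/-- A domain embeds in its fraction field `K`, to which derivations extend and over which `K[[t]]`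
is a principal ideal domain. -/
theorem isIsotropic_zeroLevel (n : ℕ) :
    IsIsotropic (n := n) (fun R [CommRing R] [Algebra ℂ R] => zeroLevel n R) := by
  intro R _ _ _ z hz g hg hp D₁ D₂
  let K := FractionRing R
  let i : R →ₗ[ℂ] K := (IsScalarTower.toAlgHom ℂ R K).toLinearMap
  have hi : IsDerivationOver i 0 :=
    ⟨map_one (algebraMap R K), map_mul (algebraMap R K), fun _ _ => by simp⟩
  have hinj : Function.Injective i := IsFractionRing.injective R K
  obtain ⟨δ₁, hδ₁, h₁⟩ := exists_extend_derivation (K := K) D₁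
  obtain ⟨δ₂, hδ₂, h₂⟩ := exists_extend_derivation (K := K) D₂
  have hcommL {D : Derivation ℂ R R} {δ : K →ₗ[ℂ] K}
      (h : ∀ r, δ (algebraMap R K r) = algebraMap R K (D r)) (f : LaurentSeries R) :
      mapLaurent i (mapLaurent (D : R →ₗ[ℂ] R) f) = mapLaurent δ (mapLaurent i f) := by
    ext m
    exact (h _).symm
  have hx := z.x_mem
  rw [hp, annihilator_parahoric hg, mem_parahoric_iff hg] at hx
  have hgK := hi.mapMat_mem_symplecticGroup hg
  have hxK : mapMat i z.x ∈ parRing hgK := by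
    rw [mem_parRing, ← hi.mapMat_sadj, ← hi.mapMat_mul, ← hi.mapMat_mul]
    exact mapMat_mem i hx.2
  have hvK : mapMat i z.x + quad (mapVec i z.v) ∈ arcMat n K := by
    rw [← mapMat_quad hi, ← mapMat_add]
    exact mapMat_mem i ((mem_zeroLevel_iff z).mp hz)
  apply hinj
  rw [map_zero, sympForm_eq_res, ← res_mapLaurent, mapLaurent_preForm hi]
  have ha {D : Derivation ℂ R R} {δ : K →ₗ[ℂ] K}
      (h : ∀ r, δ (algebraMap R K r) = algebraMap R K (D r)) :
      mapMat i (mapMat (D : R →ₗ[ℂ] R) g * g⁻¹) = mapMat δ (mapMat i g) * (mapMat i g)⁻¹ := by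
    rw [hi.mapMat_mul, inv_eq_sadj hg, inv_eq_sadj hgK, hi.mapMat_sadj]
    congr 1
    ext1 k l
    exact hcommL h _
  have hw {D : Derivation ℂ R R} {δ : K →ₗ[ℂ] K}
      (h : ∀ r, δ (algebraMap R K r) = algebraMap R K (D r)) :
      mapVec i (mapVec (D : R →ₗ[ℂ] R) z.v) = mapVec δ (mapVec i z.v) :=
    funext fun k => hcommL h _
  have hy {D : Derivation ℂ R R} {δ : K →ₗ[ℂ] K}
      (h : ∀ r, δ (algebraMap R K r) = algebraMap R K (D r)) :
      mapMat i (mapMat (D : R →ₗ[ℂ] R) z.x) = mapMat δ (mapMat i z.x) := by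
    ext1 k l
    exact hcommL h _
  simp only [velocity, mapMat_id, ha h₁, ha h₂, hw h₁, hw h₂, hy h₁, hy h₂]
  exact res_eq_zero (preForm_mem hgK hδ₁ hδ₂ hxK hvK)

end Isotropic

/-! ### Explicit formal arcs in the zero level. -/

section Arcs

variable {n : ℕ}

/-- The inclusion of constants `ℂ → ℂ[[s]]`. -/
abbrev constMap : ℂ →ₗ[ℂ] PowerSeries ℂ := Algebra.linearMap ℂ (PowerSeries ℂ)

theorem isDerivationOver_constMap : IsDerivationOver constMap 0 :=
  ⟨map_one (algebraMap ℂ _), map_mul (algebraMap ℂ _), fun _ _ => by simp⟩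

/-- Evaluation of a power series at `s = 0`. -/
abbrev evalZero : PowerSeries ℂ →ₗ[ℂ] ℂ := PowerSeries.coeff 0

/-- The derivative of a power series at `s = 0`. -/
abbrev derivZero : PowerSeries ℂ →ₗ[ℂ] ℂ := PowerSeries.coeff 1

theorem isDerivationOver_derivZero : IsDerivationOver evalZero derivZero where
  map_one := by simp
  map_mul a b := by simp
  leibniz a b := by
    rw [PowerSeries.coeff_mul, Finset.Nat.antidiagonal_succ]
    simp

/-- The parameter `s` of an arc. -/
def arcParam : LaurentSeries (PowerSeries ℂ) := HahnSeries.C PowerSeries.X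

theorem arcParam_mem : arcParam ∈ arcRing (PowerSeries ℂ) := C_mem_arcRing _

theorem evalZero_constMap (f : LaurentSeries ℂ) :
    mapLaurent evalZero (mapLaurent constMap f) = f := by
  ext m
  rw [mapLaurent_coeff, mapLaurent_coeff]
  simp

theorem derivZero_constMap (f : LaurentSeries ℂ) :
    mapLaurent derivZero (mapLaurent constMap f) = 0 := by
  ext m
  rw [mapLaurent_coeff, mapLaurent_coeff]
  simp

theorem evalZero_arcParam : mapLaurent evalZero arcParam = 0 := by
  rw [arcParam, mapLaurent_C]
  simp

theorem derivZero_arcParam : mapLaurent derivZero arcParam = 1 := by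
  rw [arcParam, mapLaurent_C]
  simp

theorem evalZero_arcParam_mul (f : LaurentSeries (PowerSeries ℂ)) :
    mapLaurent evalZero (arcParam * f) = 0 := by
  rw [isDerivationOver_derivZero.mapLaurent_mul, evalZero_arcParam, zero_mul]

theorem derivZero_arcParam_mul (f : LaurentSeries (PowerSeries ℂ)) :
    mapLaurent derivZero (arcParam * f) = mapLaurent evalZero f := by
  rw [isDerivationOver_derivZero.mapLaurent_leibniz, evalZero_arcParam, derivZero_arcParam,
    zero_mul, zero_add, one_mul]

theorem mapMat_evalZero_const (A : Mat n ℂ) : mapMat evalZero (mapMat constMap A) = A := by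
  ext1 i j; exact evalZero_constMap _

theorem mapMat_derivZero_const (A : Mat n ℂ) : mapMat derivZero (mapMat constMap A) = 0 := by
  ext1 i j; exact derivZero_constMap _

theorem mapVec_evalZero_const (v : Vec n ℂ) : mapVec evalZero (mapVec constMap v) = v := by
  ext1 i; exact evalZero_constMap _

theorem mapVec_derivZero_const (v : Vec n ℂ) : mapVec derivZero (mapVec constMap v) = 0 := by
  ext1 i; exact derivZero_constMap _

theorem mapMat_evalZero_smul (A : Mat n (PowerSeries ℂ)) :
    mapMat evalZero (arcParam • A) = 0 := by
  ext1 i j; exact evalZero_arcParam_mul _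

theorem mapMat_derivZero_smul (A : Mat n (PowerSeries ℂ)) :
    mapMat derivZero (arcParam • A) = mapMat evalZero A := by
  ext1 i j; exact derivZero_arcParam_mul _

theorem mapVec_evalZero_smul (v : Vec n (PowerSeries ℂ)) :
    mapVec evalZero (arcParam • v) = 0 := by
  ext1 i; exact evalZero_arcParam_mul _

theorem mapVec_derivZero_smul (v : Vec n (PowerSeries ℂ)) :
    mapVec derivZero (arcParam • v) = mapVec evalZero v := by
  ext1 i; exact derivZero_arcParam_mul _

/-- A double power series in `s` and `t` is a unit as soon as its value at `s = t = 0` is nonzero;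
apply this to the determinant. -/
theorem exists_inverse_arcMat {B : Mat n (PowerSeries ℂ)} (hB : B ∈ arcMat n (PowerSeries ℂ))
    (h1 : mapMat evalZero B = 1) : ∃ B' ∈ arcMat n (PowerSeries ℂ), B * B' = 1 := by
  choose B₀ hB₀ using hB
  let χ : PowerSeries (PowerSeries ℂ) →+* ℂ :=
    (PowerSeries.constantCoeff (R := ℂ)).comp (PowerSeries.constantCoeff (R := PowerSeries ℂ))
  have hχ : (Matrix.of B₀).map χ = 1 := by
    ext i j
    have h2 := congrArg (fun f : LaurentSeries ℂ => f.coeff 0) (congrFun (congrFun h1 i) j)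
    simp only [mapMat_apply, mapLaurent_coeff] at h2
    rw [← hB₀, PowerSeries.coeff_coe, if_neg (lt_irrefl 0)] at h2
    rw [Matrix.map_apply, Matrix.of_apply]
    have h3 : χ (B₀ i j) = PowerSeries.coeff 0 (PowerSeries.coeff (Int.natAbs 0) (B₀ i j)) := by
      simp [χ]
    rw [h3, h2, Matrix.one_apply, Matrix.one_apply]
    split_ifs <;> simp
  have hdet : IsUnit (Matrix.of B₀).det := by
    rw [PowerSeries.isUnit_iff_constantCoeff, PowerSeries.isUnit_iff_constantCoeff]
    change IsUnit (χ (Matrix.of B₀).det)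
    rw [RingHom.map_det, RingHom.mapMatrix_apply, hχ, Matrix.det_one]
    exact isUnit_one
  have hB' : B = (Matrix.of B₀).map (HahnSeries.ofPowerSeries ℤ (PowerSeries ℂ)) := by
    ext1 i j
    exact (hB₀ i j).symm
  refine ⟨(Matrix.of B₀)⁻¹.map (HahnSeries.ofPowerSeries ℤ (PowerSeries ℂ)),
    fun i j => ⟨_, rfl⟩, ?_⟩
  rw [hB', ← Matrix.map_mul, Matrix.mul_nonsing_inv _ hdet, Matrix.map_one _ (map_zero _)
    (map_one _)]

/-- Every element of `g_O` is the velocity of an arc in `G_O` through the identity. -/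
theorem exists_arc_group {ξ : Mat n ℂ} (hξ : ξ ∈ spO n ℂ) :
    ∃ k ∈ Matrix.symplecticGroup (Fin n) (LaurentSeries (PowerSeries ℂ)),
      k ∈ arcMat n (PowerSeries ℂ) ∧ mapMat evalZero k = 1 ∧ mapMat derivZero k = ξ := by
  rw [mem_spO_iff] at hξ
  have hD := isDerivationOver_derivZero
  -- Cayley transform: `k = (1 - η)⁻¹(1 + η)` with `η = sξ/2` is symplectic because `η` is skew, and
  -- its derivative at `s = 0` is `2 · ξ/2`.
  set ζ : Mat n (PowerSeries ℂ) := mapMat constMap (half ℂ • ξ) with hζ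
  set η : Mat n (PowerSeries ℂ) := arcParam • ζ with hη
  have hηO : η ∈ arcMat n (PowerSeries ℂ) :=
    smul_mem_arcMat arcParam_mem (mapMat_mem _ (smul_mem_arcMat half_mem_arcRing hξ.2))
  have hηs : sadj η = -η := by
    rw [hη, sadj_smul, hζ, ← isDerivationOver_constMap.mapMat_sadj, sadj_smul, hξ.1, smul_neg,
      mapMat_neg, smul_neg]
  have hη0 : mapMat evalZero η = 0 := mapMat_evalZero_smul _
  have hη1 : mapMat derivZero η = half ℂ • ξ := by
    rw [hη, mapMat_derivZero_smul, mapMat_evalZero_const]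
  have h1 : mapMat derivZero (1 : Mat n (PowerSeries ℂ)) = 0 := by
    have := mapMat_derivZero_const (1 : Mat n ℂ)
    rwa [isDerivationOver_constMap.mapMat_one] at this
  have hB0 : mapMat evalZero (1 - η) = 1 := by
    rw [mapMat_sub, hD.mapMat_one, hη0, sub_zero]
  obtain ⟨B, hB, hηB⟩ := exists_inverse_arcMat (sub_mem (one_mem _) hηO) hB0
  have hsB : sadj B * (1 + η) = 1 := by
    have := congrArg sadj hηB
    rwa [sadj_mul, sadj_sub, sadj_one, hηs, sub_neg_eq_add] at this
  have hk0 : mapMat evalZero (B * (1 + η)) = 1 := by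
    have h2 := congrArg (mapMat evalZero) hηB
    rw [hD.mapMat_mul, hB0, one_mul, hD.mapMat_one] at h2
    rw [hD.mapMat_mul, h2, mapMat_add, hD.mapMat_one, hη0, add_zero, one_mul]
  refine ⟨B * (1 + η), mem_symplecticGroup_of_mul_sadj ?_,
    mul_mem hB (add_mem (one_mem _) hηO), hk0, ?_⟩
  · rw [sadj_mul, sadj_add, sadj_one, hηs, ← sub_eq_add_neg]
    have hc : (1 + η) * (1 - η) = (1 - η) * (1 + η) := by noncomm_ring
    have e : B * (1 + η) * ((1 - η) * sadj B) = B * ((1 + η) * (1 - η)) * sadj B := by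
      simp only [Matrix.mul_assoc]
    rw [e, hc, ← Matrix.mul_assoc, mul_eq_one_comm.mp hηB, one_mul, mul_eq_one_comm.mp hsB]
  · have h2 : mapMat derivZero ((1 - η) * (B * (1 + η))) = half ℂ • ξ := by
      rw [← Matrix.mul_assoc, hηB, one_mul, mapMat_add, h1, zero_add, hη1]
    rw [hD.mapMat_leibniz, hB0, hk0, one_mul, mul_one, mapMat_sub, h1, zero_sub, hη1,
      ← sub_eq_add_neg, sub_eq_iff_eq_add, ← two_smul (LaurentSeries ℂ), smul_smul, two_mul_half,
      one_smul] at h2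
    exact h2

/-- The expansion stops at `s²`, so an arc along a line in `V_F` needs only one correction, `r`,
beyond first order. -/
theorem quad_add_smul {R : Type} [CommRing R] [Algebra ℂ R] (v w : Vec n R)
    (s : LaurentSeries R) :
    quad (v + s • w) = quad v + s • half R • symSq v w + (s * s) • quad w := by
  have h2 : half R • half R • (symSq v w + symSq v w) = half R • symSq v w := by
    rw [← two_smul (LaurentSeries R), smul_smul (half R) 2, mul_comm, two_mul_half, one_smul]
  simp only [quad, symSq_add_left, symSq_add_right, symSq_smul_left, symSq_smul_right,
    symSq_comm w v]
  rw [← h2]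
  simp only [smul_add, smul_smul]
  have e1 : half R * (half R * s) = s * (half R * half R) := by ring
  have e2 : half R * (half R * (s * s)) = s * s * (half R * half R) := by ring
  rw [e1, e2]
  abel

theorem conj_mem_symplectic {R : Type} [CommRing R] {k A : Mat n R} (hA : sadj A = -A) :
    sadj (k * A * sadj k) = -(k * A * sadj k) := by
  rw [sadj_mul, sadj_mul, sadj_sadj, hA, Matrix.neg_mul, Matrix.mul_neg, Matrix.mul_assoc]

/-- Tangent vectors to the zero level: a direction of the group action, a redundant direction,
and a direction along which the lattice is constant. -/
theorem mem_tangentsTo {z : Point n ℂ} (hz : z ∈ zeroLevel n ℂ) {g : Mat n ℂ}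
    (hg : g ∈ Matrix.symplecticGroup (Fin n) (LaurentSeries ℂ)) (hp : z.p = parahoric g)
    {ξ β y r : Mat n ℂ} {w : Vec n ℂ} (hξ : ξ ∈ spO n ℂ) (hβ : β ∈ parahoric g)
    (hy : y ∈ parahoric g) (hyw : y + half ℂ • symSq z.v w ∈ arcMat n ℂ)
    (hr : r ∈ parahoric g) (hrw : r + quad w ∈ arcMat n ℂ) :
    (⟨ξ *ᵥ z.v + w, ξ + β, ξ * z.x - z.x * ξ + y⟩ : Tangent n ℂ) ∈
      tangentsTo (fun R [CommRing R] [Algebra ℂ R] => zeroLevel n R) z := by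
  have hC := isDerivationOver_constMap
  have hD := isDerivationOver_derivZero
  obtain ⟨c, hc, rfl⟩ := hβ
  obtain ⟨k, hk, hkO, hk0, hk1⟩ := exists_arc_group hξ
  obtain ⟨m, hm, hmO, hm0, hm1⟩ := exists_arc_group hc
  have hx := z.x_mem
  rw [hp, annihilator_parahoric hg] at hx
  rw [mem_parahoric_iff hg] at hx hy hr
  have hgC := hC.mapMat_mem_symplecticGroup hg
  -- The arc is `v ↦ k(v + sw)`, `g ↦ kgm`, `x ↦ Ad_k(x + sy + s²r)`. The factor `m` only changes
  -- the lift of `p` and produces `β`. The momentum is `Ad_k` of a quadratic polynomial in `s` with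
  -- integral coefficients (`hsum`).
  set γg := k * mapMat constMap g * m with hγg
  have hγgS : γg ∈ Matrix.symplecticGroup (Fin n) (LaurentSeries (PowerSeries ℂ)) :=
    mul_mem (mul_mem hk hgC) hm
  set x₀ := mapMat constMap z.x + arcParam • mapMat constMap y +
    (arcParam * arcParam) • mapMat constMap r with hx₀
  have hpar {A : Mat n ℂ} (hA : A ∈ parRing hg) : mapMat constMap A ∈ parRing hgC := by
    rw [mem_parRing, ← hC.mapMat_sadj, ← hC.mapMat_mul, ← hC.mapMat_mul]
    exact mapMat_mem _ hA
  have hskew {A : Mat n ℂ} (hA : sadj A = -A) :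
      sadj (mapMat constMap A) = -mapMat constMap A := by
    rw [← hC.mapMat_sadj, hA, mapMat_neg]
  have hss : arcParam * arcParam ∈ arcRing (PowerSeries ℂ) := mul_mem arcParam_mem arcParam_mem
  have hx₀P : x₀ ∈ parRing hgC :=
    add_mem (add_mem (hpar hx.2) (smul_mem_parRing hgC arcParam_mem (hpar hy.2)))
      (smul_mem_parRing hgC hss (hpar hr.2))
  have hx₀S : sadj x₀ = -x₀ := by
    rw [hx₀, sadj_add, sadj_add, sadj_smul, sadj_smul, hskew hx.1, hskew hy.1, hskew hr.1]
    simp only [smul_neg, neg_add]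
  have hx₀p : k * x₀ * sadj k ∈ annihilator (parahoric γg) := by
    rw [annihilator_parahoric hγgS, mem_parahoric_iff hγgS]
    refine ⟨conj_mem_symplectic hx₀S, ?_⟩
    rw [mem_parRing, hγg, sadj_mul, sadj_mul]
    have e : sadj m * (sadj (mapMat constMap g) * sadj k) * (k * x₀ * sadj k) *
        (k * mapMat constMap g * m) = sadj m * (sadj (mapMat constMap g) * ((sadj k * k) * x₀ *
        (sadj k * k)) * mapMat constMap g) * m := by
      simp only [Matrix.mul_assoc]
    rw [e, sadj_mul_of_mem hk, one_mul, mul_one]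
    exact mul_mem (mul_mem (sadj_mem_arcMat hmO) hx₀P) hmO
  set v₀ := mapVec constMap z.v + arcParam • mapVec constMap w with hv₀
  let γ : Point n (PowerSeries ℂ) :=
    ⟨k *ᵥ v₀, parahoric γg, k * x₀ * sadj k, ⟨γg, hγgS, rfl⟩, hx₀p⟩
  have hsum : x₀ + quad v₀ = mapMat constMap (z.x + quad z.v) +
      arcParam • mapMat constMap (y + half ℂ • symSq z.v w) +
      (arcParam * arcParam) • mapMat constMap (r + quad w) := by
    rw [hv₀, quad_add_smul, mapMat_add, mapMat_add, mapMat_add, mapMat_quad hC, mapMat_quad hC,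
      mapMat_half_smul, hC.mapMat_symSq, hx₀]
    simp only [smul_add]
    abel
  have hγ : γ ∈ zeroLevel n (PowerSeries ℂ) := by
    rw [mem_zeroLevel_iff]
    change k * x₀ * sadj k + quad (k *ᵥ v₀) ∈ arcMat n _
    rw [quad_mulVec, ← Matrix.add_mul, ← Matrix.mul_add, hsum]
    exact mul_mem (mul_mem hkO (add_mem (add_mem (mapMat_mem _ ((mem_zeroLevel_iff z).mp hz))
      (smul_mem_arcMat arcParam_mem (mapMat_mem _ hyw)))
      (smul_mem_arcMat hss (mapMat_mem _ hrw)))) (sadj_mem_arcMat hkO)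
  have hv0 : mapVec evalZero v₀ = z.v := by
    rw [hv₀, mapVec_add, mapVec_evalZero_const, mapVec_evalZero_smul, add_zero]
  have hv1 : mapVec derivZero v₀ = w := by
    rw [hv₀, mapVec_add, mapVec_derivZero_const, mapVec_derivZero_smul, mapVec_evalZero_const,
      zero_add]
  have hss' : (arcParam * arcParam) • mapMat constMap r = arcParam • arcParam • mapMat constMap r :=
    (smul_smul _ _ _).symm
  have hx0 : mapMat evalZero x₀ = z.x := by
    rw [hx₀, mapMat_add, mapMat_add, mapMat_evalZero_const, mapMat_evalZero_smul, hss',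
      mapMat_evalZero_smul, add_zero, add_zero]
  have hx1 : mapMat derivZero x₀ = y := by
    rw [hx₀, mapMat_add, mapMat_add, mapMat_derivZero_const, mapMat_derivZero_smul, hss',
      mapMat_derivZero_smul, mapMat_evalZero_const, mapMat_evalZero_smul, add_zero, zero_add]
  have hg0 : mapMat evalZero γg = g := by
    rw [hγg, hD.mapMat_mul, hD.mapMat_mul, hk0, hm0, one_mul, mul_one, mapMat_evalZero_const]
  have hg1 : mapMat derivZero γg = ξ * g + g * c := by
    rw [hγg, hD.mapMat_leibniz, hD.mapMat_mul, hD.mapMat_leibniz, hk0, hk1, hm0, hm1, one_mul,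
      one_mul, mul_one, mapMat_evalZero_const, mapMat_derivZero_const, zero_add, add_comm]
  have hsk1 : mapMat derivZero (sadj k) = -ξ := by
    rw [hD.mapMat_sadj', hk1, (mem_spO_iff.mp hξ).1]
  have hsk0 : mapMat evalZero (sadj k) = 1 := by
    rw [hD.mapMat_sadj, hk0, sadj_one]
  refine ⟨γ, hγ, γg, hγgS, rfl, ?_, ?_, ?_, ?_⟩
  · change mapVec evalZero (k *ᵥ v₀) = _
    rw [hD.mapVec_mulVec, hk0, Matrix.one_mulVec, hv0]
  · change parahoric (mapMat evalZero γg) = _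
    rw [hg0, hp]
  · change mapMat evalZero (k * x₀ * sadj k) = _
    rw [hD.mapMat_mul, hD.mapMat_mul, hk0, hsk0, hx0, one_mul, mul_one]
  · refine Tangent.ext ?_ ?_ ?_
    · change mapVec derivZero (k *ᵥ v₀) = _
      rw [hD.mapVec_leibniz, hk0, hk1, hv0, hv1, Matrix.one_mulVec, add_comm]
    · change mapMat derivZero γg * (mapMat evalZero γg)⁻¹ = ξ + g * c * g⁻¹
      rw [hg0, hg1, Matrix.add_mul, Matrix.mul_assoc ξ, inv_eq_sadj hg, mul_sadj_of_mem hg, mul_one]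
    · change mapMat derivZero (k * x₀ * sadj k) = _
      rw [hD.mapMat_leibniz, hD.mapMat_leibniz, hD.mapMat_mul, hk0, hk1, hsk0, hsk1, hx0, hx1,
        one_mul, one_mul, mul_one, Matrix.mul_neg]
      change -(z.x * ξ) + (y + ξ * z.x) = ξ * z.x - z.x * ξ + y
      abel

end Arcs

/-! ### Biduality of lattices and the self-dual lattice attached to `v`. -/

section Duality

/-- A lattice is its own double dual with respect to a nondegenerate bilinear form. -/
theorem mem_of_double_dual {O F V : Type*} [CommRing O] [IsDomain O] [IsPrincipalIdealRing O]
    [Field F] [Algebra O F] [IsFractionRing O F] [AddCommGroup V] [Module F V] [Module O V]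
    [IsScalarTower O F V] (B : LinearMap.BilinForm F V) (hB : B.Nondegenerate)
    (N : Submodule O V) [Submodule.IsLattice F N] {x : V}
    (hx : ∀ y, (∀ u ∈ N, B u y ∈ (algebraMap O F).range) → B x y ∈ (algebraMap O F).range) :
    x ∈ N := by
  have : Module.IsTorsionFree O F := by
    have := (faithfulSMul_iff_algebraMap_injective O F).mpr (IsFractionRing.injective O F)
    infer_instance
  have hone (f : F) : f ∈ (1 : Submodule O F) ↔ f ∈ (algebraMap O F).range :=
    Submodule.mem_one
  let b := Module.Free.chooseBasis O N
  -- Over a principal ideal domain the lattice is free, and a basis of it is a basis of `V`, for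
  -- which biduality is known.
  have hspan : N = Submodule.span O (Set.range (b.extendOfIsLattice F)) := by
    have h1 : Set.range (b.extendOfIsLattice F) = N.subtype '' Set.range b := by
      rw [← Set.range_comp]
      congr 1
      ext i
      simp
    rw [h1, ← Submodule.map_span, b.span_eq, Submodule.map_top, Submodule.range_subtype]
  have h2 := LinearMap.BilinForm.dualSubmodule_dualSubmodule_flip_of_basis (R := O) B hB
    (b.extendOfIsLattice F)
  rw [← hspan] at h2
  rw [← h2, LinearMap.BilinForm.mem_dualSubmodule]
  intro y hy
  rw [hone]
  refine hx y fun u hu => ?_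
  rw [← hone]
  exact hy u hu

variable {n : ℕ}

/-- `V_O` as a lattice in `V_F`. -/
def vecLattice (n : ℕ) : Submodule (PowerSeries ℂ) (Vec n ℂ) :=
  LinearMap.range ((Algebra.linearMap (PowerSeries ℂ) (LaurentSeries ℂ)).compLeft (Fin n ⊕ Fin n))

theorem mem_vecLattice_iff {u : Vec n ℂ} : u ∈ vecLattice n ↔ ∀ i, u i ∈ arcRing ℂ := by
  constructor
  · rintro ⟨p, rfl⟩ i
    exact ⟨p i, rfl⟩
  · intro h
    choose p hp using h
    exact ⟨p, funext hp⟩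

instance : Submodule.IsLattice (LaurentSeries ℂ) (vecLattice n) where
  fg := Module.Finite.iff_fg.mp (Module.Finite.range _)
  span_eq_top := by
    rw [eq_top_iff]
    intro u _
    rw [pi_eq_sum_univ' u]
    refine Submodule.sum_mem _ fun i _ => Submodule.smul_mem _ _ (Submodule.subset_span ?_)
    refine mem_vecLattice_iff.mpr fun j => ?_
    rw [Pi.single_apply]
    split_ifs
    · exact (arcRing ℂ).one_mem
    · exact (arcRing ℂ).zero_mem

/-- The integral matrices as a lattice. -/
def matLattice (n : ℕ) : Submodule (PowerSeries ℂ) (Mat n ℂ) :=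
  LinearMap.range ((Algebra.linearMap (PowerSeries ℂ) (LaurentSeries ℂ)).mapMatrix
    (m := Fin n ⊕ Fin n) (n := Fin n ⊕ Fin n))

theorem mem_matLattice_iff {A : Mat n ℂ} : A ∈ matLattice n ↔ A ∈ arcMat n ℂ := by
  constructor
  · rintro ⟨p, rfl⟩ i j
    exact ⟨p i j, rfl⟩
  · intro h
    choose p hp using h
    exact ⟨p, funext fun i => funext fun j => hp i j⟩

theorem matLattice_fg : (matLattice n).FG :=
  Module.Finite.iff_fg.mp (Module.Finite.range _)

instance : Submodule.IsLattice (LaurentSeries ℂ) (matLattice n) where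
  fg := matLattice_fg
  span_eq_top := by
    rw [eq_top_iff]
    intro A _
    rw [Matrix.matrix_eq_sum_single A]
    refine Submodule.sum_mem _ fun i _ => Submodule.sum_mem _ fun j _ => ?_
    have : Matrix.single i j (A i j) = A i j • Matrix.single i j (1 : LaurentSeries ℂ) := by
      rw [Matrix.smul_single, smul_eq_mul, mul_one]
    rw [this]
    refine Submodule.smul_mem _ _ (Submodule.subset_span (mem_matLattice_iff.mpr fun k l => ?_))
    rw [Matrix.single_apply]
    split_ifs
    · exact (arcRing ℂ).one_mem
    · exact (arcRing ℂ).zero_mem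

/-- The trace form as a bilinear form. -/
def matTraceForm (n : ℕ) : LinearMap.BilinForm (LaurentSeries ℂ) (Mat n ℂ) :=
  LinearMap.mk₂ _ (fun A B => (A * B).trace) (fun A A' B => by rw [Matrix.add_mul, Matrix.trace_add])
    (fun c A B => by rw [Matrix.smul_mul, Matrix.trace_smul])
    (fun A B B' => by rw [Matrix.mul_add, Matrix.trace_add])
    (fun c A B => by rw [Matrix.mul_smul, Matrix.trace_smul])

theorem matTraceForm_apply (A B : Mat n ℂ) : matTraceForm n A B = (A * B).trace := rfl

theorem matTraceForm_nondegenerate : (matTraceForm n).Nondegenerate := by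
  constructor
  · intro A hA
    refine Matrix.ext_iff_trace_mul_right.mpr fun B => ?_
    rw [zero_mul, Matrix.trace_zero]
    exact hA B
  · intro A hA
    refine Matrix.ext_iff_trace_mul_left.mpr fun B => ?_
    rw [mul_zero, Matrix.trace_zero]
    exact hA B

variable {g : Mat n ℂ} (hg : g ∈ Matrix.symplecticGroup (Fin n) (LaurentSeries ℂ))

/-- The orthogonal complement of `g_O ∩ Ad_g g_O` in `sp` is `g_O + Ad_g g_O`. -/
theorem exists_split_of_orthogonal {a : Mat n ℂ} (ha : sadj a = -a)
    (h : ∀ η ∈ arcMat n ℂ ⊓ parRing hg, sadj η = -η → (a * η).trace ∈ arcRing ℂ) :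
    ∃ ξ ∈ spO n ℂ, ∃ β ∈ parahoric g, a = ξ + β := by
  have h' : ∀ η ∈ arcMat n ℂ ⊓ parRing hg, (a * η).trace ∈ arcRing ℂ := by
    intro η hη
    rw [← trace_mul_skewPart ha]
    exact h _ ⟨smul_mem_arcMat half_mem_arcRing (sub_mem hη.1 (sadj_mem_arcMat hη.1)),
      smul_mem_parRing hg half_mem_arcRing (sub_mem hη.2 (sadj_mem_parRing hg hη.2))⟩
      (sadj_half_smul_sub η)
  let conj : Mat n ℂ →ₗ[PowerSeries ℂ] Mat n ℂ :=
    (LinearMap.mulLeft (PowerSeries ℂ) g).comp (LinearMap.mulRight (PowerSeries ℂ) (sadj g))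
  have hconj (A : Mat n ℂ) : conj A = g * A * sadj g := (Matrix.mul_assoc g A (sadj g)).symm
  -- The trace dual of this sum is the intersection of the two orders, so biduality puts `a` in `N`.
  -- Taking skew parts then returns the splitting to `sp`.
  let N := matLattice n ⊔ (matLattice n).map conj
  have hN : Submodule.IsLattice (LaurentSeries ℂ) N :=
    Submodule.IsLattice.of_le_of_isLattice_of_fg (LaurentSeries ℂ) le_sup_left
      (matLattice_fg.sup (matLattice_fg.map _))
  have haN : a ∈ N := by
    refine mem_of_double_dual (matTraceForm n) matTraceForm_nondegenerate N fun η hη => ?_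
    refine h' η ⟨?_, ?_⟩
    · refine mem_arcMat_of_res fun B hB => res_eq_zero ?_
      rw [Matrix.trace_mul_comm]
      exact hη B (Submodule.mem_sup_left (mem_matLattice_iff.mpr hB))
    · refine (mem_parRing hg).mpr (mem_arcMat_of_res fun B hB => res_eq_zero ?_)
      have := hη (g * B * sadj g) (Submodule.mem_sup_right
        ⟨B, mem_matLattice_iff.mpr hB, hconj B⟩)
      rw [matTraceForm_apply] at this
      have e : (sadj g * η * g * B).trace = (g * B * sadj g * η).trace := by
        rw [Matrix.mul_assoc _ g, Matrix.trace_mul_comm]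
        simp only [Matrix.mul_assoc]
      rw [e]
      exact this
  obtain ⟨A, hA, _, ⟨B, hB, rfl⟩, rfl⟩ := Submodule.mem_sup.mp haN
  rw [SetLike.mem_coe, mem_matLattice_iff] at hB
  rw [mem_matLattice_iff] at hA
  rw [hconj] at ha ⊢
  have hBP := conj_mem_parRing hg hB
  refine ⟨half ℂ • (A - sadj A), mem_spO_iff.mpr ⟨sadj_half_smul_sub _, smul_mem_arcMat
    half_mem_arcRing (sub_mem hA (sadj_mem_arcMat hA))⟩, half ℂ • (g * B * sadj g -
    sadj (g * B * sadj g)), (mem_parahoric_iff hg).mpr ⟨sadj_half_smul_sub _, smul_mem_parRing hg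
    half_mem_arcRing (sub_mem hBP (sadj_mem_parRing hg hBP))⟩, ?_⟩
  conv_lhs => rw [eq_skewPart ha, sadj_add]
  rw [← smul_add]
  congr 1
  abel

/-- The lattice `Av + (V_O ∩ (Av)^⊥)`, where `A` is the order preserving two given lattices. -/
def adaptedLattice (v : Vec n ℂ) : Set (Vec n ℂ) :=
  {u | ∃ a ∈ arcMat n ℂ ⊓ parRing hg, ∃ l ∈ vecLattice n,
    (∀ b ∈ arcMat n ℂ ⊓ parRing hg, sform (b *ᵥ v) l ∈ arcRing ℂ) ∧ u = a *ᵥ v + l}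

theorem mulVec_mem_vecLattice {A : Mat n ℂ} (hA : A ∈ arcMat n ℂ) {l : Vec n ℂ}
    (hl : l ∈ vecLattice n) : A *ᵥ l ∈ vecLattice n := by
  rw [mem_vecLattice_iff] at hl ⊢
  intro i
  rw [Matrix.mulVec, dotProduct]
  exact sum_mem fun j _ => (arcRing ℂ).mul_mem (hA i j) (hl j)

theorem sform_mem_of_vecLattice {l l' : Vec n ℂ} (hl : l ∈ vecLattice n)
    (hl' : l' ∈ vecLattice n) : sform l l' ∈ arcRing ℂ := by
  have := mem_vecLattice_iff.mp (mulVec_mem_vecLattice J_mem_arcMat hl')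
  rw [sform, dotProduct]
  exact sum_mem fun i _ => (arcRing ℂ).mul_mem (mem_vecLattice_iff.mp hl i) (this i)

theorem mem_vecLattice_of_sform {y : Vec n ℂ}
    (h : ∀ l ∈ vecLattice n, sform l y ∈ arcRing ℂ) : y ∈ vecLattice n := by
  have hJ : Matrix.J (Fin n) (LaurentSeries ℂ) *ᵥ y ∈ vecLattice n := by
    refine mem_vecLattice_iff.mpr fun i => ?_
    have hi : (Pi.single i 1 : Vec n ℂ) ∈ vecLattice n := by
      refine mem_vecLattice_iff.mpr fun j => ?_
      rw [Pi.single_apply]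
      split_ifs
      · exact one_mem _
      · exact zero_mem _
    have := h _ hi
    rwa [sform, single_one_dotProduct] at this
  have := mulVec_mem_vecLattice J_mem_arcMat hJ
  rw [Matrix.mulVec_mulVec, Matrix.J_squared, Matrix.neg_mulVec, Matrix.one_mulVec] at this
  simpa using neg_mem this

theorem sadj_mem_inf {a : Mat n ℂ} (ha : a ∈ arcMat n ℂ ⊓ parRing hg) :
    sadj a ∈ arcMat n ℂ ⊓ parRing hg :=
  ⟨sadj_mem_arcMat ha.1, sadj_mem_parRing hg ha.2⟩

/-- The order is closed under `sadj`, so the orthogonal complement of `Av` is stable under it as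
well. -/
theorem mulVec_mem_adaptedLattice {v u : Vec n ℂ} (hu : u ∈ adaptedLattice hg v) {b : Mat n ℂ}
    (hb : b ∈ arcMat n ℂ ⊓ parRing hg) : b *ᵥ u ∈ adaptedLattice hg v := by
  obtain ⟨a, ha, l, hl, hal, rfl⟩ := hu
  refine ⟨b * a, mul_mem hb ha, b *ᵥ l, mulVec_mem_vecLattice hb.1 hl, fun c hc => ?_, ?_⟩
  · have := hal (sadj b * c) (mul_mem (sadj_mem_inf hg hb) hc)
    rwa [← Matrix.mulVec_mulVec, sform_mulVec (sadj b), sadj_sadj] at this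
  · rw [Matrix.mulVec_add, Matrix.mulVec_mulVec]

theorem self_mem_adaptedLattice (v : Vec n ℂ) : v ∈ adaptedLattice hg v :=
  ⟨1, one_mem _, 0, zero_mem _, fun _ _ => by simp [sform, zero_mem], by simp⟩

variable {v : Vec n ℂ}
  (hv : ∀ a ∈ arcMat n ℂ ⊓ parRing hg, ∀ b ∈ arcMat n ℂ ⊓ parRing hg,
    sform (a *ᵥ v) (b *ᵥ v) ∈ arcRing ℂ)
include hv

theorem sform_mem_of_adaptedLattice {u u' : Vec n ℂ} (hu : u ∈ adaptedLattice hg v)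
    (hu' : u' ∈ adaptedLattice hg v) : sform u u' ∈ arcRing ℂ := by
  obtain ⟨a, ha, l, hl, hal, rfl⟩ := hu
  obtain ⟨a', ha', l', hl', hal', rfl⟩ := hu'
  rw [sform_add_left, sform_add_right, sform_add_right, sform_comm l (a' *ᵥ v)]
  exact add_mem (add_mem (hv a ha a' ha') (hal' a ha))
    (add_mem (neg_mem (hal a' ha')) (sform_mem_of_vecLattice hl hl'))

/-- The adapted lattice is coisotropic, hence self-dual. -/
theorem mem_adaptedLattice_of_res {w : Vec n ℂ}
    (hw : ∀ u ∈ adaptedLattice hg v, res (sform w u) = 0) : w ∈ adaptedLattice hg v := by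
  -- The lattice is stable under `O`, so vanishing residues upgrade to integrality.
  have hw' : ∀ u ∈ adaptedLattice hg v, sform w u ∈ arcRing ℂ := by
    intro u hu
    refine mem_arcRing_of_res fun f hf => ?_
    have hf1 : f • (1 : Mat n ℂ) ∈ arcMat n ℂ ⊓ parRing hg :=
      ⟨smul_mem_arcMat hf (one_mem _), smul_mem_parRing hg hf (one_mem _)⟩
    have := hw _ (mulVec_mem_adaptedLattice hg hu hf1)
    rwa [Matrix.smul_mulVec, Matrix.one_mulVec, sform_smul_right, mul_comm] at this
  let A : Submodule (PowerSeries ℂ) (Mat n ℂ) :=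
    { carrier := {a | a ∈ arcMat n ℂ ⊓ parRing hg}
      add_mem' := (arcMat n ℂ ⊓ parRing hg).add_mem
      zero_mem' := (arcMat n ℂ ⊓ parRing hg).zero_mem
      smul_mem' := fun c a ha => by
        rw [← algebraMap_smul (LaurentSeries ℂ)]
        exact ⟨smul_mem_arcMat ⟨c, rfl⟩ ha.1, smul_mem_parRing hg ⟨c, rfl⟩ ha.2⟩ }
  have hAfg : A.FG := by
    have : Module.Finite (PowerSeries ℂ) (matLattice n) := Module.Finite.iff_fg.mpr matLattice_fg
    have : IsNoetherian (PowerSeries ℂ) A :=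
      isNoetherian_of_le (t := matLattice n) fun a ha => mem_matLattice_iff.mpr ha.1
    exact Module.Finite.iff_fg.mp inferInstance
  let ev : Mat n ℂ →ₗ[PowerSeries ℂ] Vec n ℂ :=
    { toFun := fun a => a *ᵥ v
      map_add' := fun a b => Matrix.add_mulVec a b v
      map_smul' := fun c a => Matrix.smul_mulVec c a v }
  let N := vecLattice n ⊔ A.map ev
  have hN : Submodule.IsLattice (LaurentSeries ℂ) N :=
    Submodule.IsLattice.of_le_of_isLattice_of_fg (LaurentSeries ℂ) le_sup_left
      (Submodule.FG.sup Submodule.IsLattice.fg (hAfg.map _))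
  -- A vector pairing integrally with `V_O + Av` lies in `V_O ∩ (Av)^⊥`, hence in the adapted
  -- lattice, hence pairs integrally with `w`. Biduality gives `w ∈ V_O + Av`.
  have hwN : w ∈ N := by
    refine mem_of_double_dual (Matrix.toBilin' (Matrix.J (Fin n) (LaurentSeries ℂ)))
      (LinearMap.BilinForm.nondegenerate_toBilin'_of_det_ne_zero' _
        (Matrix.isUnit_det_J (Fin n) (LaurentSeries ℂ)).ne_zero) N fun y hy => ?_
    have hB (u u' : Vec n ℂ) :
        Matrix.toBilin' (Matrix.J (Fin n) (LaurentSeries ℂ)) u u' = sform u u' :=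
      Matrix.toBilin'_apply' _ _ _
    simp only [hB] at hy ⊢
    exact hw' y ⟨0, zero_mem _, y,
      mem_vecLattice_of_sform fun l hl => hy l (Submodule.mem_sup_left hl),
      fun b hb => hy _ (Submodule.mem_sup_right ⟨b, hb, rfl⟩),
      by rw [Matrix.zero_mulVec, zero_add]⟩
  obtain ⟨l, hl, _, ⟨a, ha, rfl⟩, rfl⟩ := Submodule.mem_sup.mp hwN
  refine ⟨a, ha, l, hl, fun b hb => ?_, add_comm _ _⟩
  -- Both `w` and `av` are orthogonal to `Av`, so `l = w - av` is too.
  have h1 := hw' _ (mulVec_mem_adaptedLattice hg (self_mem_adaptedLattice hg v) hb)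
  rw [sform_add_left, sform_comm l] at h1
  have h2 := sub_mem (hv a ha b hb) h1
  have e : sform (a *ᵥ v) (b *ᵥ v) - (-sform (b *ᵥ v) l + sform (ev a) (b *ᵥ v)) =
      sform (b *ᵥ v) l := by
    change sform (a *ᵥ v) (b *ᵥ v) - (-sform (b *ᵥ v) l + sform (a *ᵥ v) (b *ᵥ v)) = _
    ring
  rwa [e] at h2

end Duality

/-! ### Coisotropy of the zero level. -/

section Coisotropic

variable {n : ℕ} {g : Mat n ℂ} (hg : g ∈ Matrix.symplecticGroup (Fin n) (LaurentSeries ℂ))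

/-- Split `q` as `ξ + β` and take `y = -β`. This supplies the first- and second-order covectors
required by `mem_tangentsTo`. -/
theorem exists_correction {q : Mat n ℂ} (hq : sadj q = -q)
    (h : ∀ η ∈ arcMat n ℂ ⊓ parRing hg, sadj η = -η → (q * η).trace ∈ arcRing ℂ) :
    ∃ y ∈ parahoric g, y + q ∈ arcMat n ℂ := by
  obtain ⟨ξ, hξ, β, hβ, rfl⟩ := exists_split_of_orthogonal hg hq h
  rw [mem_parahoric_iff hg] at hβ
  refine ⟨-β, (mem_parahoric_iff hg).mpr ⟨by rw [sadj_neg, hβ.1], neg_mem hβ.2⟩, ?_⟩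
  rw [neg_add_cancel_comm_assoc]
  exact (mem_spO_iff.mp hξ).2

theorem isCoisotropic_zeroLevel (n : ℕ) :
    IsCoisotropic (n := n) (fun R [CommRing R] [Algebra ℂ R] => zeroLevel n R) := by
  intro z hz τ hτ horth
  obtain ⟨g, hg, hp⟩ := z.exists_lift
  have hx := z.x_mem
  rw [hp, annihilator_parahoric hg, mem_parahoric_iff hg] at hx
  obtain ⟨hxs, hxP⟩ := hx
  have hxq := (mem_zeroLevel_iff z).mp hz
  obtain ⟨ha, hy0, hya⟩ := hτ
  rw [mem_sp_iff] at ha hy0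
  rw [hp, annihilator_parahoric hg, Ring.lie_def] at hya
  have h0O : (0 : Mat n ℂ) ∈ spO n ℂ := zero_mem _
  have h0P : (0 : Mat n ℂ) ∈ parahoric g :=
    (mem_parahoric_iff hg).mpr ⟨by simp [sadj], zero_mem _⟩
  have hq0 : (0 : Mat n ℂ) + quad (0 : Vec n ℂ) ∈ arcMat n ℂ := by
    have : quad (0 : Vec n ℂ) = 0 := by simp [quad, symSq]
    rw [this, add_zero]
    exact zero_mem _
  have hsymSq0 (v : Vec n ℂ) : symSq v 0 = 0 := by simp [symSq]
  -- orthogonality to the cotangent directions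
  have hτa : ∀ η ∈ arcMat n ℂ ⊓ parRing hg, sadj η = -η → (τ.a * η).trace ∈ arcRing ℂ := by
    intro η hη hηs
    refine mem_arcRing_of_res fun f hf => ?_
    have hfη : f • η ∈ parahoric g := (mem_parahoric_iff hg).mpr
      ⟨by rw [sadj_smul, hηs, smul_neg], smul_mem_parRing hg hf hη.2⟩
    have h := horth _ (mem_tangentsTo hz hg hp (w := 0) (r := 0) h0O h0P hfη
      (by rw [hsymSq0, smul_zero, add_zero]; exact smul_mem_arcMat hf hη.1) h0P hq0)
    rw [sympForm_eq_res] at h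
    rw [← h, preForm]
    congr 1
    simp only [Matrix.zero_mulVec, add_zero, zero_mul, mul_zero, sub_self, zero_add,
      Matrix.trace_zero, sub_zero]
    rw [Matrix.smul_mul, Matrix.trace_smul, smul_eq_mul, Matrix.trace_mul_comm, mul_comm]
    simp [sform]
  obtain ⟨ξ, hξ, β, hβ, hξβ⟩ := exists_split_of_orthogonal hg ha hτa
  have hξ' := mem_spO_iff.mp hξ
  have hβ' := (mem_parahoric_iff hg).mp hβ
  -- orthogonality to the directions of the group action
  have hys : sadj (τ.y + half ℂ • symSq z.v τ.w) = -(τ.y + half ℂ • symSq z.v τ.w) := by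
    rw [sadj_add, hy0, sadj_smul, sadj_symSq, smul_neg, neg_add]
  have hdμ : τ.y + half ℂ • symSq z.v τ.w ∈ arcMat n ℂ := by
    rw [mem_arcMat_iff_of_skew hys]
    intro B hB
    have h := horth _ (mem_tangentsTo hz hg hp (w := 0) (r := 0) (y := 0) hB h0P h0P
      (by rw [hsymSq0, smul_zero, add_zero]; exact zero_mem _) h0P hq0)
    have e := preForm_eq (two_mul_half (R := ℂ)) (x := z.x) (ξ₁ := 0) (ξ₂ := B) (b₁ := τ.a)
      (b₂ := 0) (y₁ := τ.y) (y₂ := 0) (by simp [sadj]) (mem_spO_iff.mp hB).1 z.v τ.w 0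
    rw [sympForm_eq_res] at h
    simp only [Matrix.zero_mulVec, zero_mul, mul_zero, zero_add, sub_self] at e
    rw [e] at h
    simp only [Matrix.trace_zero, sub_zero, add_zero] at h
    have h0 : sform τ.w 0 = 0 := by simp [sform]
    rw [h0, zero_sub, res_neg, neg_eq_zero] at h
    exact h
  -- After the action of `ξ` is removed, `w` and `y` satisfy every condition of `mem_tangentsTo`
  -- except the existence of `r`, which will follow from `w` lying in the adapted lattice.
  set w := τ.w - ξ *ᵥ z.v with hw
  set y := τ.y - (ξ * z.x - z.x * ξ) with hy
  have hyP : y ∈ parahoric g := by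
    have hadβ : β * z.x - z.x * β ∈ parRing hg :=
      sub_mem (mul_mem hβ'.2 hxP) (mul_mem hxP hβ'.2)
    refine (mem_parahoric_iff hg).mpr ⟨?_, ?_⟩
    · rw [hy, sadj_sub, sadj_sub, sadj_mul, sadj_mul, hy0, hxs, hξ'.1]
      noncomm_ring
    · have e : y = (τ.y - (τ.a * z.x - z.x * τ.a)) + (β * z.x - z.x * β) := by
        rw [hy, hξβ]
        noncomm_ring
      rw [e]
      exact add_mem ((mem_parahoric_iff hg).mp hya).2 hadβ
  have hyw : y + half ℂ • symSq z.v w ∈ arcMat n ℂ := by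
    have e : y + half ℂ • symSq z.v w = τ.y + half ℂ • symSq z.v τ.w -
        (ξ * (z.x + quad z.v) - (z.x + quad z.v) * ξ) := by
      have hl : ξ * (z.x + quad z.v) - (z.x + quad z.v) * ξ =
          (ξ * z.x - z.x * ξ) + half ℂ • symSq z.v (ξ *ᵥ z.v) := by
        rw [← lie_quad hξ'.1]
        noncomm_ring
      rw [hl, hy, hw, symSq_sub_right, smul_sub]
      abel
    rw [e]
    exact sub_mem hdμ (sub_mem (mul_mem hξ'.2 hxq) (mul_mem hxq hξ'.2))
  have hτeq : τ = ⟨ξ *ᵥ z.v + w, ξ + β, ξ * z.x - z.x * ξ + y⟩ :=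
    Tangent.ext (add_sub_cancel _ _).symm hξβ (add_sub_cancel _ _).symm
  have hvv : ∀ a ∈ arcMat n ℂ ⊓ parRing hg, ∀ b ∈ arcMat n ℂ ⊓ parRing hg,
      sform (a *ᵥ z.v) (b *ᵥ z.v) ∈ arcRing ℂ :=
    fun a ha b hb => sform_mulVec_mem hg hxP hxq ha hb
  have hsym : ∀ u ∈ adaptedLattice hg z.v, ∀ u' ∈ adaptedLattice hg z.v,
      ∀ η ∈ arcMat n ℂ ⊓ parRing hg, sform (η *ᵥ u) u' ∈ arcRing ℂ :=
    fun u hu u' hu' η hη =>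
      sform_mem_of_adaptedLattice hg hvv (mulVec_mem_adaptedLattice hg hu hη) hu'
  have hv := self_mem_adaptedLattice hg z.v
  -- The obstruction to `r` is the failure of `⟨ηu, u⟩` to be integral; it vanishes because the
  -- lattice is isotropic and stable under the order.
  have hquad : ∀ u ∈ adaptedLattice hg z.v, ∃ r ∈ parahoric g, r + quad u ∈ arcMat n ℂ := by
    intro u hu
    refine exists_correction hg (sadj_quad u) fun η hη hηs => ?_
    rw [trace_quad_mul hηs]
    exact mul_mem half_mem_arcRing (hsym u hu u hu η hη)
  -- orthogonality to the adapted lattice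
  have hwΛ : w ∈ adaptedLattice hg z.v := by
    refine mem_adaptedLattice_of_res hg hvv fun u hu => ?_
    obtain ⟨r, hr, hru⟩ := hquad u hu
    obtain ⟨yu, hyu, hyuu⟩ : ∃ yu ∈ parahoric g, yu + half ℂ • symSq z.v u ∈ arcMat n ℂ := by
      refine exists_correction hg (by rw [sadj_smul, sadj_symSq, smul_neg]) fun η hη hηs => ?_
      rw [trace_symSq_mul_of_skew two_mul_half hηs]
      exact hsym _ hv u hu η hη
    have h := horth _ (mem_tangentsTo hz hg hp h0O h0P hyu hyuu hr hru)
    rw [hτeq, sympForm_eq_res, preForm_eq two_mul_half hξ'.1 (by simp [sadj])] at h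
    simp only [mul_zero, zero_mul, sub_self, Matrix.trace_zero, add_zero, sub_zero] at h
    rw [res_add, res_add, res_eq_zero (trace_mem_arcRing (mul_mem hyuu hξ'.2)),
      res_eq_zero (trace_mem_of_parRing hg (mul_mem ((mem_parahoric_iff hg).mp hyu).2 hβ'.2)),
      add_zero, add_zero] at h
    exact h
  obtain ⟨r, hr, hrw⟩ := hquad w hwΛ
  rw [hτeq]
  exact mem_tangentsTo hz hg hp hξ hβ hyP hyw hr hrw

end Coisotropic

end Mirabolic

end

theorem mainTheorem5 (n : ℕ) :
    Mirabolic.IsLagrangian (fun (R : Type) [CommRing R] [Algebra ℂ R] =>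
      Mirabolic.zeroLevel n R) :=
  ⟨Mirabolic.isIsotropic_zeroLevel n, Mirabolic.isCoisotropic_zeroLevel n⟩
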